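/- Let $w\in\mathfrak S_n$ be fully supported, i.e. $\{w(1),\dots,w(r)\}\neq\{1,\dots,r\}$ for all $1\le r<n$. Elnitsky's polygon $X(w)$ is the equilateral $2n$-gon whose sides are labeled $1,\dots,n,w(n),\dots,w(1)$ in counterclockwise order from the top vertex, in which sides with the same label are parallel and the first $n$ sides (the leftside boundary) form half of a convex, centrally symmetric $2n$-gon. A rhombic tiling of $X(w)$ is a tiling by rhombi whose edges are all congruent and parallel to sides of $X(w)$; the labels of a tile are the labels of the sides to which its edges are parallel. A tile is a left-perimeter tile if it shares two consecutive edges with the leftside boundary, and a forced left-perimeter tile for $w$ is a tile that appears as a left-perimeter tile in every rhombic tiling of $X(w)$. Then for every $1\le k<n$ the following are equivalent: (i) there is a forced left-perimeter tile for $w$ with labels $\{k,k+1\}$; (ii) $w^{-1}(k)>w^{-1}(k+1)$, and $k$ and $k+1$ do not occur together in a $321$-pattern of $w$ (that is, there are no positions $a<b<c$ with $w(a)>w(b)>w(c)$ and $k,k+1\in\{w(a),w(b),w(c)\}$); (iii) $k+1$ is a left-to-right maximum of $w$ and $k$ is a right-to-left minimum of $w$ (that is, every entry to the left of $k+1$ in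 the one-line notation $w(1)\cdots w(n)$ is smaller than $k+1$, and every entry to the right of $k$ is larger than $k$). -/

import Mathlib

noncomputable section

namespace Elnitsky

/-! Labels `1, …, n` are represented by `Fin n` (shifted by one), so a permutation in one-line
notation `w(1) w(2) ⋯ w(n)` is `w : Equiv.Perm (Fin n)`. The plane is `ℂ`. -/

/-- `w` is fully supported: `{w(1), …, w(r)} ≠ {1, …, r}` for all `1 ≤ r < n`. -/
def FullySupported {n : ℕ} (w : Equiv.Perm (Fin n)) : Prop :=
  ∀ r : ℕ, 1 ≤ r → r < n → w '' {i : Fin n | i.val < r} ≠ {i : Fin n | i.val < r}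

/-- Admissible edge directions: the sides `1, …, n`, traversed in this order, all go downwards and
keep turning counterclockwise by a total angle less than `π`. Up to a rotation, this says that they
form half of a convex (centrally symmetric) equilateral `2n`-gon, on its left side. -/
def Admissible {n : ℕ} (θ : Fin n → ℝ) : Prop :=
  StrictMono θ ∧ ∀ i, θ i ∈ Set.Ioo Real.pi (2 * Real.pi)

/-- The unit vector along which a side labeled `i` is traversed from top to bottom. -/
def dir {n : ℕ} (θ : Fin n → ℝ) (i : Fin n) : ℂ :=
  Complex.exp ((θ i : ℂ) * Complex.I)

/-- The vertex reached from the top vertex `0` after the first `m` sides of the downward path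
whose consecutive sides are labeled `σ(1), σ(2), …, σ(n)`. -/
def pathVertex {n : ℕ} (θ : Fin n → ℝ) (σ : Equiv.Perm (Fin n)) (m : ℕ) : ℂ :=
  ∑ i : Fin n with i.val < m, dir θ (σ i)

/-- The side number `m` of that path; its label is `σ m`. -/
def pathEdge {n : ℕ} (θ : Fin n → ℝ) (σ : Equiv.Perm (Fin n)) (m : Fin n) : Set ℂ :=
  segment ℝ (pathVertex θ σ m.val) (pathVertex θ σ (m.val + 1))

/-- The side labeled `m` of the leftside boundary, which is labeled `1, …, n` from top to bottom. -/
def leftEdge {n : ℕ} (θ : Fin n → ℝ) (m : Fin n) : Set ℂ :=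
  pathEdge θ 1 m

/-- The leftside boundary of the polygon. -/
def leftBoundary {n : ℕ} (θ : Fin n → ℝ) : Set ℂ :=
  ⋃ m : Fin n, leftEdge θ m

/-- The rightside boundary of the polygon of `w`, labeled `w(1), …, w(n)` from top to bottom. -/
def rightBoundary {n : ℕ} (θ : Fin n → ℝ) (w : Equiv.Perm (Fin n)) : Set ℂ :=
  ⋃ m : Fin n, pathEdge θ w m

/-- Elnitsky's polygon `X(w)` (as a closed region): both boundary paths go strictly downwards, so
the region that they enclose consists of the points that lie, at their height, between the point
of the left path and the point of the right path. -/
def polygon {n : ℕ} (θ : Fin n → ℝ) (w : Equiv.Perm (Fin n)) : Set ℂ :=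
  {p | ∃ l ∈ leftBoundary θ, ∃ r ∈ rightBoundary θ w,
    l.im = p.im ∧ r.im = p.im ∧ l.re ≤ p.re ∧ p.re ≤ r.re}

/-- A rhombic tile, given by its top vertex and its labels `{i < j}`. -/
structure Tile (n : ℕ) where
  /-- the top vertex -/
  top : ℂ
  /-- the smaller label -/
  i : Fin n
  /-- the larger label -/
  j : Fin n
  lt : i < j

/-- The set of labels of a tile. -/
def Tile.labels {n : ℕ} (t : Tile n) : Set (Fin n) := {t.i, t.j}

/-- The closed rhombus occupied by a tile: its sides are unit segments parallel to the sides of the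
polygon with the labels of the tile. -/
def Tile.carrier {n : ℕ} (θ : Fin n → ℝ) (t : Tile n) : Set ℂ :=
  {p | ∃ a ∈ Set.Icc (0 : ℝ) 1, ∃ b ∈ Set.Icc (0 : ℝ) 1,
    p = t.top + (a : ℂ) * dir θ t.i + (b : ℂ) * dir θ t.j}

/-- The four edges of a tile. -/
def Tile.edges {n : ℕ} (θ : Fin n → ℝ) (t : Tile n) : Set (Set ℂ) :=
  {segment ℝ t.top (t.top + dir θ t.i),
   segment ℝ t.top (t.top + dir θ t.j),
   segment ℝ (t.top + dir θ t.j) (t.top + dir θ t.i + dir θ t.j),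
   segment ℝ (t.top + dir θ t.i) (t.top + dir θ t.i + dir θ t.j)}

/-- `T` is a rhombic tiling of `X(w)`: the tiles cover the polygon exactly and have pairwise
disjoint interiors. -/
structure IsRhombicTiling {n : ℕ} (θ : Fin n → ℝ) (w : Equiv.Perm (Fin n))
    (T : Finset (Tile n)) : Prop where
  cover : (⋃ t ∈ T, t.carrier θ) = polygon θ w
  disjoint : ∀ s ∈ T, ∀ t ∈ T, s ≠ t →
    Disjoint (interior (s.carrier θ)) (interior (t.carrier θ))

/-- The tile shares two consecutive edges with the leftside boundary. -/
def SharesLeft {n : ℕ} (θ : Fin n → ℝ) (t : Tile n) : Prop :=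
  ∃ m m' : Fin n, m'.val = m.val + 1 ∧ leftEdge θ m ∈ t.edges θ ∧ leftEdge θ m' ∈ t.edges θ

/-- `t` is a forced left-perimeter tile for `w`: it appears, as a left-perimeter tile, in every
rhombic tiling of `X(w)`. -/
def IsForcedLeftTile {n : ℕ} (θ : Fin n → ℝ) (w : Equiv.Perm (Fin n)) (t : Tile n) : Prop :=
  ∀ T : Finset (Tile n), IsRhombicTiling θ w T → t ∈ T ∧ SharesLeft θ t

/-- The values `x` and `y` occur together in a `321`-pattern of `w`. -/
def TogetherIn321 {n : ℕ} (w : Equiv.Perm (Fin n)) (x y : Fin n) : Prop :=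
  ∃ a b c : Fin n, a < b ∧ b < c ∧ w b < w a ∧ w c < w b ∧
    x ∈ ({w a, w b, w c} : Set (Fin n)) ∧ y ∈ ({w a, w b, w c} : Set (Fin n))

/-- The value `v` is a left-to-right maximum of `w`: all entries to its left are smaller. -/
def IsLRMax {n : ℕ} (w : Equiv.Perm (Fin n)) (v : Fin n) : Prop :=
  ∀ p : Fin n, p < w.symm v → w p < v

/-- The value `v` is a right-to-left minimum of `w`: all entries to its right are larger. -/
def IsRLMin {n : ℕ} (w : Equiv.Perm (Fin n)) (v : Fin n) : Prop :=
  ∀ p : Fin n, w.symm v < p → v < w p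

end Elnitsky

end

/-! A rhombic tiling of $X(w)$ amounts to a way of sweeping a downward path from the leftside
boundary (the identity) to the rightside boundary (`w`), one tile at a time. Each tile crossed
exchanges two adjacent labels that are still in increasing order, and no exchange is ever reversed.
`Peels` records such sweeps. `Peels.isRhombicTiling` shows that a sweep from the identity gives a
tiling, and `IsRhombicTiling.peels` that every tiling arises so. Full support ensures that no side
of the leftside boundary is left uncovered.

(iii) implies (i): in any sweep, consider the first step that moves $k$ or $k+1$. It cannot carry a
smaller entry to the right of $k$ or a larger one to the left of $k+1$, because that inversion would
survive in `w`. So it exchanges $k$ and $k+1$ themselves, in their original place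
(`Peels.exists_tile_of_fixed`).

(i) implies (ii): the labels of a tile are inverted in `w`. If $k,k+1$ lie in a 321-pattern, its
three entries can be made adjacent by sweeping backwards from `w` (`Peels.exists_consecutive`). Then
$k$ and $k+1$ can be exchanged while the third entry is on the wrong side. That tile is the only one
with its labels (`Peels.eq_of_labels`), and it is off the leftside boundary because the boundary
vertices are extremal (`prefix_of_pathVertex_eq`).

(ii) and (iii) are compared by pure combinatorics in `not_togetherIn321_iff`. -/

noncomputable section

namespace Elnitsky

open Equiv

/-! ### Combinatorics of sweeps: inversions, sorting, 321-patterns. -/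

section

variable {n : ℕ}

/-- The tile that sits in the corner of the path `σ` between its consecutive sides `m` and `m'`. -/
def cornerTile (θ : Fin n → ℝ) (σ : Perm (Fin n)) (m m' : Fin n) (h : σ m < σ m') : Tile n :=
  ⟨pathVertex θ σ m.val, σ m, σ m', h⟩

/-- `Peels θ w σ T`: the path `σ` can be moved to the path `w` across one corner tile after another,
and `T` is the set of the tiles that are crossed. -/
inductive Peels (θ : Fin n → ℝ) (w : Perm (Fin n)) : Perm (Fin n) → Set (Tile n) → Prop
  | refl : Peels θ w w ∅
  | step (σ : Perm (Fin n)) (m m' : Fin n) (hm : m'.val = m.val + 1) (h : σ m < σ m')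
      (T : Set (Tile n)) (hT : Peels θ w (σ * swap m m') T) :
      Peels θ w σ (insert (cornerTile θ σ m m' h) T)

theorem swap_lt_swap {m m' p q : Fin n} (hm : m'.val = m.val + 1) (hpq : p < q)
    (hne : ¬ (p = m ∧ q = m')) : swap m m' p < swap m m' q := by
  simp only [swap_apply_def, Fin.ext_iff, Fin.lt_def] at *
  split_ifs <;> omega

theorem mul_swap_symm_apply (σ : Perm (Fin n)) (m m' v : Fin n) :
    (σ * swap m m').symm v = swap m m' (σ.symm v) := by
  rw [Equiv.symm_apply_eq]; simp

/-- Crossing an ascent keeps the order of every other pair. -/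
theorem symm_lt_of_mul_swap {σ : Perm (Fin n)} {m m' : Fin n} (hm : m'.val = m.val + 1)
    {a b : Fin n} (hab : (σ * swap m m').symm a < (σ * swap m m').symm b)
    (hne : ¬ (a = σ m' ∧ b = σ m)) : σ.symm a < σ.symm b := by
  rw [mul_swap_symm_apply, mul_swap_symm_apply] at hab
  have := swap_lt_swap hm hab (by
    rintro ⟨h1, h2⟩
    apply hne
    rw [swap_apply_eq_iff, swap_apply_left, Equiv.symm_apply_eq] at h1
    rw [swap_apply_eq_iff, swap_apply_right, Equiv.symm_apply_eq] at h2
    exact ⟨h1, h2⟩)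
  simpa using this

theorem mul_swap_symm_lt {σ : Perm (Fin n)} {m m' : Fin n} (hm : m'.val = m.val + 1)
    {a b : Fin n} (hab : σ.symm a < σ.symm b)
    (hne : ¬ (a = σ m ∧ b = σ m')) : (σ * swap m m').symm a < (σ * swap m m').symm b := by
  rw [mul_swap_symm_apply, mul_swap_symm_apply]
  refine swap_lt_swap hm hab ?_
  rintro ⟨h1, h2⟩
  exact hne ⟨by rw [← h1]; simp, by rw [← h2]; simp⟩

namespace Peels

variable {θ : Fin n → ℝ} {w σ : Perm (Fin n)} {T : Set (Tile n)}

theorem finite (h : Peels θ w σ T) : T.Finite := by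
  induction h with
  | refl => exact Set.finite_empty
  | step σ m m' hm h T hT ih => exact ih.insert _

/-- Inversions persist. -/
theorem inv_of_inv (h : Peels θ w σ T) {a b : Fin n} (hab : a < b)
    (hσ : σ.symm b < σ.symm a) : w.symm b < w.symm a := by
  induction h with
  | refl => exact hσ
  | step σ m m' hm h T hT ih =>
    refine ih (mul_swap_symm_lt hm hσ ?_)
    rintro ⟨rfl, rfl⟩
    exact absurd hab h.not_gt

/-- Steps only create inversions, so a pair that is yet to be crossed cannot be inverted already. -/
theorem symm_lt_of_mem (h : Peels θ w σ T) {s : Tile n} (hs : s ∈ T) :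
    σ.symm s.i < σ.symm s.j := by
  induction h with
  | refl => exact hs.elim
  | step σ m m' hm h T hT ih =>
    rcases hs with rfl | hs
    · simp [cornerTile, Fin.lt_def, hm]
    · refine symm_lt_of_mul_swap hm (ih hs) ?_
      rintro ⟨h1, h2⟩
      have := s.lt
      rw [h1, h2] at this
      exact absurd this h.not_gt

theorem not_labels_mul_swap {m m' : Fin n} (hm : m'.val = m.val + 1)
    (h : Peels θ w (σ * swap m m') T) {s : Tile n} (hs : s ∈ T) :
    ¬ (s.i = σ m ∧ s.j = σ m') := by
  rintro ⟨h1, h2⟩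
  have := h.symm_lt_of_mem hs
  rw [h1, h2, mul_swap_symm_apply, mul_swap_symm_apply] at this
  simp [Fin.lt_def, hm] at this

theorem inv_of_mem (h : Peels θ w σ T) {s : Tile n} (hs : s ∈ T) :
    w.symm s.j < w.symm s.i := by
  induction h with
  | refl => exact hs.elim
  | step σ m m' hm h T hT ih =>
    rcases hs with rfl | hs
    · refine hT.inv_of_inv h ?_
      rw [mul_swap_symm_apply, mul_swap_symm_apply]
      simp [cornerTile, Fin.lt_def, hm]
    · exact ih hs

/-- A pair of labels is inverted once it has been crossed, and from then on no tile can carry it. -/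
theorem eq_of_labels (h : Peels θ w σ T) {s t : Tile n} (hs : s ∈ T) (ht : t ∈ T)
    (hi : s.i = t.i) (hj : s.j = t.j) : s = t := by
  induction h with
  | refl => exact hs.elim
  | step σ m m' hm h T hT ih =>
    rcases hs with rfl | hs <;> rcases ht with rfl | ht
    · rfl
    · exact (hT.not_labels_mul_swap hm ht ⟨hi.symm, hj.symm⟩).elim
    · exact (hT.not_labels_mul_swap hm hs ⟨hi, hj⟩).elim
    · exact ih hs ht

end Peels

theorem exists_descent_of_lt {σ : Fin n → Fin n} {p q : Fin n} (hpq : p < q) (h : σ q < σ p) :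
    ∃ m m' : Fin n, m'.val = m.val + 1 ∧ p ≤ m ∧ m' ≤ q ∧ σ m' < σ m := by
  by_contra! hcon
  have key : ∀ d : ℕ, ∀ r : Fin n, r.val = p.val + d → r ≤ q → σ p ≤ σ r := by
    intro d
    induction d with
    | zero => intro r hr _; rw [show r = p from Fin.ext (by simpa using hr)]
    | succ d ih =>
      intro r hr hrq
      have hlt : p.val + d < n := by have := r.isLt; omega
      have h1 := ih ⟨p.val + d, hlt⟩ rfl (by rw [Fin.le_def] at *; simp; omega)
      exact h1.trans (hcon ⟨p.val + d, hlt⟩ r (by simp; omega) (by rw [Fin.le_def]; simp) hrq)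
  exact absurd (key (q.val - p.val) q (by rw [Fin.lt_def] at hpq; omega) le_rfl) h.not_ge

theorem exists_descent {σ : Perm (Fin n)} (h : σ ≠ 1) :
    ∃ m m' : Fin n, m'.val = m.val + 1 ∧ σ m' < σ m := by
  by_contra! hcon
  have hmono : Monotone σ := by
    intro p q hpq
    by_contra! hlt
    have hne : p < q := lt_of_le_of_ne hpq (by rintro rfl; exact lt_irrefl _ hlt)
    obtain ⟨m, m', hm, -, -, hd⟩ := exists_descent_of_lt hne hlt
    exact absurd hd (hcon m m' hm).not_gt
  have hs : StrictMono σ := hmono.strictMono_of_injective σ.injective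
  have hrange : Set.range σ = Set.range (id : Fin n → Fin n) := by
    rw [σ.surjective.range_eq, Set.range_id]
  have hid := (hs.range_inj strictMono_id).1 hrange
  exact h (Equiv.ext fun i => congrFun hid i)

/-- A measure of disorder that drops when a descent is undone. -/
def disorder (σ : Perm (Fin n)) : ℕ := ∑ l : Fin n, (n - l.val) * (σ l).val

theorem disorder_mul_swap_lt {σ : Perm (Fin n)} {m m' : Fin n} (hm : m'.val = m.val + 1)
    (h : σ m' < σ m) : disorder (σ * swap m m') < disorder σ := by
  have hne : m ≠ m' := by rintro rfl; omega
  unfold disorder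
  rw [← Finset.add_sum_erase _ _ (Finset.mem_univ m),
    ← Finset.add_sum_erase (Finset.univ) (fun l : Fin n => (n - l.val) * (σ l).val) (Finset.mem_univ m),
    ← Finset.add_sum_erase _ _ (Finset.mem_erase.2 ⟨hne.symm, Finset.mem_univ m'⟩),
    ← Finset.add_sum_erase (Finset.univ.erase m) (fun l : Fin n => (n - l.val) * (σ l).val)
      (Finset.mem_erase.2 ⟨hne.symm, Finset.mem_univ m'⟩)]
  have hrest : ∑ l ∈ (Finset.univ.erase m).erase m', (n - l.val) * ((σ * swap m m') l).val
      = ∑ l ∈ (Finset.univ.erase m).erase m', (n - l.val) * (σ l).val := by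
    refine Finset.sum_congr rfl fun l hl => ?_
    simp only [Finset.mem_erase] at hl
    rw [Perm.mul_apply, swap_apply_of_ne_of_ne hl.2.1 hl.1]
  rw [hrest]
  simp only [Perm.mul_apply, swap_apply_left, swap_apply_right]
  -- The two positions have weights `d + 1` and `d`, so the sum drops by `σ m - σ m'`.
  obtain ⟨d, hd⟩ : ∃ d, n = m'.val + d := ⟨n - m'.val, by have := m'.isLt; omega⟩
  have e1 : n - m.val = d + 1 := by omega
  have e2 : n - m'.val = d := by omega
  rw [e1, e2]
  rw [Fin.lt_def] at h
  nlinarith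

theorem mul_swap_mul_swap (σ : Perm (Fin n)) (m m' : Fin n) :
    σ * swap m m' * swap m m' = σ := by
  rw [mul_assoc, swap_mul_self, mul_one]

namespace Peels

variable {θ : Fin n → ℝ} {w σ : Perm (Fin n)} {T : Set (Tile n)}

/-- Undoing a descent prolongs the peeling. -/
theorem undo (h : Peels θ w σ T) {m m' : Fin n} (hm : m'.val = m.val + 1) (hd : σ m' < σ m) :
    Peels θ w (σ * swap m m') (insert (cornerTile θ (σ * swap m m') m m' (by simpa using hd)) T) :=
  step _ m m' hm _ T (by rwa [mul_swap_mul_swap])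

/-- Sorting `σ` by undoing descents prolongs the sweep back to the leftside boundary, so tiles
prescribed near `w` can be completed to a tiling. -/
theorem exists_one (h : Peels θ w σ T) : ∃ T', T ⊆ T' ∧ Peels θ w 1 T' := by
  induction hN : disorder σ using Nat.strong_induction_on generalizing σ T with
  | _ N ih =>
    by_cases h1 : σ = 1
    · subst h1; exact ⟨T, subset_rfl, h⟩
    · obtain ⟨m, m', hm, hd⟩ := exists_descent h1
      obtain ⟨T', hT', hp⟩ := ih _ (hN ▸ disorder_mul_swap_lt hm hd) (h.undo hm hd) rfl
      exact ⟨T', (Set.subset_insert _ _).trans hT', hp⟩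

/-- A `321`-pattern of `w` can be made to stand in consecutive positions. -/
theorem exists_consecutive (h : Peels θ w σ T) {x y z : Fin n} (hxy : y < x) (hyz : z < y)
    (h1 : σ.symm x < σ.symm y) (h2 : σ.symm y < σ.symm z) :
    ∃ τ T', Peels θ w τ T' ∧ (τ.symm y).val = (τ.symm x).val + 1 ∧
      (τ.symm z).val = (τ.symm y).val + 1 := by
  induction hN : disorder σ using Nat.strong_induction_on generalizing σ T with
  | _ N ih =>
    by_cases hex : ∃ m m' : Fin n, m'.val = m.val + 1 ∧ σ m' < σ m ∧ ¬ (x = σ m ∧ y = σ m') ∧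
        ¬ (y = σ m ∧ z = σ m')
    · obtain ⟨m, m', hm, hd, hn1, hn2⟩ := hex
      exact ih _ (hN ▸ disorder_mul_swap_lt hm hd) (h.undo hm hd) (mul_swap_symm_lt hm h1 hn1)
        (mul_swap_symm_lt hm h2 hn2) rfl
    -- Now only `x, y` and `y, z` can be adjacent descents. Some descent lies between the positions
    -- of `x` and `y`; it cannot be `y, z`, which starts too late. The same reasoning applies
    -- between `y` and `z`.
    · push Not at hex
      refine ⟨σ, T, h, ?_, ?_⟩
      · obtain ⟨m, m', hm, hl, hr, hd⟩ := exists_descent_of_lt (σ := σ) h1 (by simpa using hxy)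
        by_cases hc : x = σ m ∧ y = σ m'
        · rw [hc.1, hc.2]; simpa using hm
        · have hy := (hex m m' hm hd (fun hx hy => hc ⟨hx, hy⟩)).1
          rw [hy, symm_apply_apply, Fin.le_def] at hr
          omega
      · obtain ⟨m, m', hm, hl, hr, hd⟩ := exists_descent_of_lt (σ := σ) h2 (by simpa using hyz)
        by_cases hc : x = σ m ∧ y = σ m'
        · rw [hc.2, symm_apply_apply, Fin.le_def] at hl
          omega
        · have hy := hex m m' hm hd (fun hx hy => hc ⟨hx, hy⟩)
          rw [hy.1, hy.2]; simpa using hm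

end Peels

theorem pathVertex_eq_sum (θ : Fin n → ℝ) (σ : Perm (Fin n)) (m : ℕ) :
    pathVertex θ σ m = ∑ v : Fin n with (σ.symm v).val < m, dir θ v := by
  unfold pathVertex
  rw [Finset.sum_filter, Finset.sum_filter,
    ← Equiv.sum_comp σ (fun v => if (σ.symm v).val < m then dir θ v else 0)]
  simp only [symm_apply_apply]

theorem pathVertex_congr (θ : Fin n → ℝ) {σ τ : Perm (Fin n)} {m : ℕ}
    (h : ∀ v, (σ.symm v).val < m ↔ (τ.symm v).val < m) :
    pathVertex θ σ m = pathVertex θ τ m := by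
  simp only [pathVertex_eq_sum, h]

namespace Peels

variable {θ : Fin n → ℝ} {w σ : Perm (Fin n)} {T : Set (Tile n)}

/-- As long as the values `k` and `k'` are at home, nothing may pass them, so that the tile with
these labels sits at the leftside boundary. -/
theorem exists_tile_of_fixed (h : Peels θ w σ T) {k k' : Fin n} (hk : k'.val = k.val + 1)
    (hmax : IsLRMax w k') (hmin : IsRLMin w k) (hinv : w.symm k' < w.symm k)
    (hlow : ∀ v, σ.symm v < k ↔ v < k) (hkk : σ.symm k = k) (hkk' : σ.symm k' = k') :
    ∃ t ∈ T, t.i = k ∧ t.j = k' ∧ t.top = pathVertex θ 1 k.val := by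
  induction h with
  | refl =>
    rw [hkk, hkk', Fin.lt_def] at hinv
    omega
  | step σ m m' hm h T hT ih =>
    have hσk : σ k = k := by rw [← hkk, apply_symm_apply, hkk]
    have hσk' : σ k' = k' := by rw [← hkk', apply_symm_apply, hkk']
    have hswap : (σ * swap m m').symm (σ m') < (σ * swap m m').symm (σ m) := by
      rw [mul_swap_symm_apply, mul_swap_symm_apply]
      simp [Fin.lt_def, hm]
    have hinv' := hT.inv_of_inv h hswap
    by_cases hmk : m = k
    · obtain rfl : m' = k' := Fin.ext (by rw [hm, hk, hmk])
      subst hmk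
      refine ⟨_, Set.mem_insert _ _, hσk, hσk', ?_⟩
      exact pathVertex_congr θ fun v => hlow v
    -- The entry `σ m` is smaller than `k` by `hlow` and would pass to its right for good, against
    -- `hmin`.
    · by_cases hmk' : m' = k
      · subst hmk'
        have h1 := hmin (w.symm (σ m)) (by rwa [hσk] at hinv')
        rw [apply_symm_apply] at h1
        have h2 := (hlow (σ m)).1 (by rw [symm_apply_apply, Fin.lt_def]; omega)
        exact absurd h1 h2.not_gt
      -- The entry `σ m'` is larger than `k'` and would pass to its left for good, against `hmax`.
      · by_cases hmk2 : m = k'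
        · subst hmk2
          have h1 := hmax (w.symm (σ m')) (by rwa [hσk'] at hinv')
          rw [apply_symm_apply] at h1
          rw [hσk'] at h
          exact absurd h1 h.not_gt
        · have hm'k : m' ≠ k' := fun e => hmk (Fin.ext (by have := congrArg Fin.val e; omega))
          obtain ⟨t, ht, h3⟩ := ih (fun v => by
              rw [mul_swap_symm_apply, ← hlow v]
              simp only [swap_apply_def, Fin.ext_iff, Fin.lt_def] at *
              split_ifs <;> omega)
            (by rw [mul_swap_symm_apply, hkk]; exact swap_apply_of_ne_of_ne (Ne.symm hmk) (Ne.symm hmk'))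
            (by rw [mul_swap_symm_apply, hkk']; exact swap_apply_of_ne_of_ne (Ne.symm hmk2) (Ne.symm hm'k))
          exact ⟨t, Set.mem_insert_of_mem _ ht, h3⟩

end Peels

/-- If `k` came before `k'`, the entries before `k'` would be exactly the smaller values, against
full support. -/
theorem symm_lt_symm_of_fullySupported {w : Perm (Fin n)} (hw : FullySupported w) {k k' : Fin n}
    (hk : k'.val = k.val + 1) (hmax : IsLRMax w k') (hmin : IsRLMin w k) :
    w.symm k' < w.symm k := by
  by_contra! hle
  have hlt : w.symm k < w.symm k' := lt_of_le_of_ne hle (by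
    intro e
    have := congrArg Fin.val (w.symm.injective e)
    omega)
  have hiff : ∀ p, p < w.symm k' ↔ w p < k' := by
    intro p
    refine ⟨hmax p, fun h => ?_⟩
    by_contra! hp
    have := hmin p (hlt.trans_le hp)
    rw [Fin.lt_def] at this h
    omega
  have hcard : (w.symm k').val = k'.val := by
    have h1 : (Finset.univ.filter (fun p => p < w.symm k')).card
        = (Finset.univ.filter (fun p => p < k')).card := by
      refine Finset.card_bij (fun p _ => w p) ?_ (fun a _ b _ hab => w.injective hab) ?_
      · intro a ha
        simpa [hiff] using ha
      · intro b hb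
        exact ⟨w.symm b, by simpa [hiff] using hb, by simp⟩
    simpa [Finset.filter_gt_eq_Iio] using h1
  refine hw k'.val (by omega) k'.isLt ?_
  ext v
  simp only [Set.mem_image, Set.mem_ofPred_eq]
  constructor
  · rintro ⟨p, hp, rfl⟩
    exact (hiff p).1 (by rw [Fin.lt_def, hcard]; exact hp)
  · intro hv
    refine ⟨w.symm v, ?_, by simp⟩
    rw [← hcard]
    exact (hiff _).2 (by rw [apply_symm_apply]; exact hv)

/-- A larger entry before `k'`, or a smaller one after `k`, completes the inversion `k', k` to a
321-pattern. Conversely, consecutive values are neighbours in any 321-pattern, and its third entry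
violates one of the two conditions in (iii). -/
theorem not_togetherIn321_iff {w : Perm (Fin n)} (hw : FullySupported w) {k k' : Fin n}
    (hk : k'.val = k.val + 1) :
    (w.symm k' < w.symm k ∧ ¬ TogetherIn321 w k k') ↔ (IsLRMax w k' ∧ IsRLMin w k) := by
  have hne : k ≠ k' := by rintro rfl; omega
  constructor
  · rintro ⟨hinv, hnot⟩
    refine ⟨fun p hp => ?_, fun p hp => ?_⟩
    · by_contra! hle
      have hlt : k' < w p := lt_of_le_of_ne hle (by rintro rfl; simp at hp)
      exact hnot ⟨p, _, _, hp, hinv, by simpa using hlt, by simp [Fin.lt_def, hk], by simp, by simp⟩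
    · by_contra! hle
      have hlt : w p < k := lt_of_le_of_ne hle (by rintro rfl; simp at hp)
      exact hnot ⟨_, _, p, hinv, hp, by simp [Fin.lt_def, hk], by simpa using hlt, by simp, by simp⟩
  · rintro ⟨hmax, hmin⟩
    refine ⟨symm_lt_symm_of_fullySupported hw hk hmax hmin, ?_⟩
    rintro ⟨a, b, c, hab, hbc, h1, h2, hx, hy⟩
    simp only [Set.mem_insert_iff, Set.mem_singleton_iff] at hx hy
    have h3 : k = w b → k < w c := fun e => hmin c (by rwa [e, symm_apply_apply])
    have h4 : k' = w b → w a < k' := fun e => hmax a (by rwa [e, symm_apply_apply])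
    simp only [Fin.lt_def, Fin.ext_iff] at h1 h2 h3 h4 hx hy
    omega

end

/-! ### Paths as graphs over depth, and tiles as regions between two graphs. -/

section

variable {n : ℕ} {θ : Fin n → ℝ}

/-- The height of a side labeled `i`. -/
def hgt (θ : Fin n → ℝ) (i : Fin n) : ℝ := -Real.sin (θ i)

/-- The horizontal displacement per unit of depth along a side labeled `i`. -/
def slope (θ : Fin n → ℝ) (i : Fin n) : ℝ := Real.cos (θ i) / hgt θ i

theorem Admissible.hgt_pos (hθ : Admissible θ) (i : Fin n) : 0 < hgt θ i := by
  have h := hθ.2 i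
  have := Real.sin_pos_of_pos_of_lt_pi (x := θ i - Real.pi) (by linarith [h.1]) (by linarith [h.2])
  rw [Real.sin_sub_pi] at this
  exact this

/-- Without denominators this is `sin (θ j - θ i) > 0`: the angles lie in an interval of length `π`.
-/
theorem Admissible.slope_strictMono (hθ : Admissible θ) : StrictMono (slope θ) := by
  intro i j hij
  unfold slope
  rw [div_lt_div_iff₀ (hθ.hgt_pos i) (hθ.hgt_pos j)]
  have hi := hθ.2 i
  have hj := hθ.2 j
  have := Real.sin_pos_of_pos_of_lt_pi (x := θ j - θ i) (by linarith [hθ.1 hij])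
    (by linarith [hi.1, hj.2])
  rw [Real.sin_sub] at this
  unfold hgt
  linarith

theorem Admissible.dir_re (hθ : Admissible θ) (i : Fin n) :
    (dir θ i).re = slope θ i * hgt θ i := by
  rw [slope, div_mul_cancel₀ _ (hθ.hgt_pos i).ne', dir, Complex.exp_ofReal_mul_I_re]

theorem dir_im (θ : Fin n → ℝ) (i : Fin n) : (dir θ i).im = -hgt θ i := by
  rw [hgt, neg_neg, dir, Complex.exp_ofReal_mul_I_im]

/-- The depth below the top vertex of the vertex number `m` of the path `σ`. -/
def depth (θ : Fin n → ℝ) (σ : Perm (Fin n)) (m : ℕ) : ℝ := -(pathVertex θ σ m).im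

/-- `v` truncated to the interval `[0, h]`. -/
def clip (v h : ℝ) : ℝ := max 0 (min v h)

/-- The horizontal coordinate of the point of the path `σ` at depth `y`. -/
def abscissa (θ : Fin n → ℝ) (σ : Perm (Fin n)) (y : ℝ) : ℝ :=
  ∑ m : Fin n, slope θ (σ m) * clip (y - depth θ σ m.val) (hgt θ (σ m))

theorem continuous_abscissa (θ : Fin n → ℝ) (σ : Perm (Fin n)) : Continuous (abscissa θ σ) := by
  unfold abscissa clip
  fun_prop

theorem pathVertex_zero (θ : Fin n → ℝ) (σ : Perm (Fin n)) : pathVertex θ σ 0 = 0 := by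
  simp [pathVertex]

theorem pathVertex_succ (θ : Fin n → ℝ) (σ : Perm (Fin n)) (m : Fin n) :
    pathVertex θ σ (m.val + 1) = pathVertex θ σ m.val + dir θ (σ m) := by
  unfold pathVertex
  have : (Finset.univ.filter fun i : Fin n => i.val < m.val + 1)
      = insert m (Finset.univ.filter fun i : Fin n => i.val < m.val) := by
    ext i
    simp only [Finset.mem_filter, Finset.mem_univ, true_and, Finset.mem_insert, Fin.ext_iff]
    omega
  rw [this, Finset.sum_insert (by simp), add_comm]

theorem depth_zero (θ : Fin n → ℝ) (σ : Perm (Fin n)) : depth θ σ 0 = 0 := by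
  simp [depth, pathVertex_zero]

theorem depth_succ (θ : Fin n → ℝ) (σ : Perm (Fin n)) (m : Fin n) :
    depth θ σ (m.val + 1) = depth θ σ m.val + hgt θ (σ m) := by
  simp only [depth, pathVertex_succ, Complex.add_im, dir_im]
  ring

theorem depth_eq_sum (θ : Fin n → ℝ) (σ : Perm (Fin n)) (m : ℕ) :
    depth θ σ m = ∑ i : Fin n with i.val < m, hgt θ (σ i) := by
  simp [depth, pathVertex, dir_im]

theorem depth_mono (hθ : Admissible θ) (σ : Perm (Fin n)) : Monotone (depth θ σ) := by
  intro a b hab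
  rw [depth_eq_sum, depth_eq_sum]
  refine Finset.sum_le_sum_of_subset_of_nonneg ?_ fun i _ _ => (hθ.hgt_pos _).le
  intro i
  simp only [Finset.mem_filter, Finset.mem_univ, true_and]
  omega

theorem depth_card (θ : Fin n → ℝ) (σ : Perm (Fin n)) : depth θ σ n = ∑ i, hgt θ i := by
  rw [depth_eq_sum, ← Equiv.sum_comp σ]
  simp

theorem abscissa_edge (hθ : Admissible θ) (σ : Perm (Fin n)) (m : Fin n) {y : ℝ}
    (h0 : depth θ σ m.val ≤ y) (h1 : y ≤ depth θ σ m.val + hgt θ (σ m)) :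
    abscissa θ σ y = (pathVertex θ σ m.val).re + slope θ (σ m) * (y - depth θ σ m.val) := by
  have hre : (pathVertex θ σ m.val).re
      = ∑ l : Fin n, if l.val < m.val then slope θ (σ l) * hgt θ (σ l) else 0 := by
    rw [pathVertex, Complex.re_sum, Finset.sum_filter]
    simp only [hθ.dir_re]
  have hm : slope θ (σ m) * (y - depth θ σ m.val)
      = ∑ l : Fin n, if l = m then slope θ (σ l) * (y - depth θ σ l.val) else 0 := by
    simp
  rw [hre, hm, ← Finset.sum_add_distrib, abscissa]
  refine Finset.sum_congr rfl fun l _ => ?_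
  have hl := hθ.hgt_pos (σ l)
  rcases lt_trichotomy l m with hlm | rfl | hlm
  · have h2 : depth θ σ l.val + hgt θ (σ l) ≤ depth θ σ m.val := by
      rw [← depth_succ]
      exact depth_mono hθ σ hlm
    rw [if_pos (Fin.lt_def.1 hlm), if_neg hlm.ne, clip, min_eq_right (by linarith), max_eq_right hl.le, add_zero]
  · rw [if_neg (lt_irrefl _), if_pos rfl, clip, min_eq_left (by linarith),
      max_eq_right (by linarith), zero_add]
  · have h2 : y ≤ depth θ σ l.val := by
      refine h1.trans ?_
      rw [← depth_succ]
      exact depth_mono hθ σ hlm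
    rw [if_neg (by simpa using hlm.le), if_neg hlm.ne', clip, max_eq_left, mul_zero, add_zero]
    exact (min_le_left _ _).trans (by linarith)

theorem exists_edge (σ : Perm (Fin n)) (hn : 0 < n) {y : ℝ} (h0 : 0 ≤ y)
    (h1 : y ≤ ∑ i, hgt θ i) :
    ∃ m : Fin n, depth θ σ m.val ≤ y ∧ y ≤ depth θ σ m.val + hgt θ (σ m) := by
  by_contra! hcon
  have key : ∀ j : ℕ, j ≤ n → depth θ σ j ≤ y := by
    intro j
    induction j with
    | zero => intro _; rwa [depth_zero]
    | succ j ih =>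
      intro hj
      have := hcon ⟨j, hj⟩ (ih (by omega))
      rw [← depth_succ] at this
      exact this.le
  have h2 := hcon ⟨n - 1, by omega⟩ (key _ (by simp))
  rw [← depth_succ] at h2
  simp only [Nat.sub_add_cancel hn, depth_card] at h2
  linarith

theorem mem_pathEdge (hθ : Admissible θ) (σ : Perm (Fin n)) (m : Fin n) (p : ℂ) :
    p ∈ pathEdge θ σ m ↔ depth θ σ m.val ≤ -p.im ∧ -p.im ≤ depth θ σ m.val + hgt θ (σ m) ∧
      p.re = (pathVertex θ σ m.val).re + slope θ (σ m) * (-p.im - depth θ σ m.val) := by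
  have hh := hθ.hgt_pos (σ m)
  rw [pathEdge, pathVertex_succ, segment_eq_image']
  simp only [add_sub_cancel_left, Set.mem_image, Set.mem_Icc, Complex.ext_iff, Complex.add_re,
    Complex.add_im, Complex.smul_re, Complex.smul_im, hθ.dir_re, dir_im, depth, smul_eq_mul]
  constructor
  · rintro ⟨t, ⟨h0, h1⟩, h2, h3⟩
    rw [← h2, ← h3]
    refine ⟨by nlinarith, by nlinarith, by ring⟩
  · rintro ⟨h0, h1, h2⟩
    refine ⟨(-p.im + (pathVertex θ σ m.val).im) / hgt θ (σ m), ⟨by apply div_nonneg <;> linarith,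
      by rw [div_le_one hh]; linarith⟩, ?_, ?_⟩
    · rw [h2]; field_simp; ring
    · field_simp; ring

theorem mem_iUnion_pathEdge (hθ : Admissible θ) (σ : Perm (Fin n)) (hn : 0 < n) (p : ℂ) :
    p ∈ ⋃ m, pathEdge θ σ m ↔ (0 ≤ -p.im ∧ -p.im ≤ ∑ i, hgt θ i) ∧ p.re = abscissa θ σ (-p.im) := by
  rw [Set.mem_iUnion]
  constructor
  · rintro ⟨m, hm⟩
    rw [mem_pathEdge hθ] at hm
    obtain ⟨h0, h1, h2⟩ := hm
    refine ⟨⟨?_, ?_⟩, by rw [h2, abscissa_edge hθ σ m h0 h1]⟩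
    · rw [← depth_zero θ σ]; exact (depth_mono hθ σ (Nat.zero_le _)).trans h0
    · rw [← depth_card θ σ]
      refine h1.trans ?_
      rw [← depth_succ]
      exact depth_mono hθ σ m.isLt
  · rintro ⟨⟨h0, h1⟩, h2⟩
    obtain ⟨m, h3, h4⟩ := exists_edge σ hn h0 h1
    exact ⟨m, by rw [mem_pathEdge hθ]; exact ⟨h3, h4, by rw [h2, abscissa_edge hθ σ m h3 h4]⟩⟩

theorem mem_polygon (hθ : Admissible θ) (w : Perm (Fin n)) (hn : 0 < n) (p : ℂ) :
    p ∈ polygon θ w ↔ (0 ≤ -p.im ∧ -p.im ≤ ∑ i, hgt θ i) ∧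
      abscissa θ 1 (-p.im) ≤ p.re ∧ p.re ≤ abscissa θ w (-p.im) := by
  simp only [polygon, Set.mem_ofPred_eq, leftBoundary, rightBoundary, leftEdge,
    mem_iUnion_pathEdge hθ _ hn]
  constructor
  · rintro ⟨l, ⟨hl, hl'⟩, r, ⟨hr, hr'⟩, h1, h2, h3, h4⟩
    rw [h1] at hl hl'
    rw [h2] at hr'
    exact ⟨hl, hl' ▸ h3, hr' ▸ h4⟩
  · rintro ⟨h0, h3, h4⟩
    exact ⟨⟨abscissa θ 1 (-p.im), p.im⟩, ⟨h0, rfl⟩, ⟨abscissa θ w (-p.im), p.im⟩, ⟨h0, rfl⟩, rfl,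
      rfl, h3, h4⟩

/-- The horizontal coordinate, relative to the top vertex, of the point of the left side of a tile
at relative depth `v`. -/
def Tile.left (θ : Fin n → ℝ) (t : Tile n) (v : ℝ) : ℝ :=
  max (slope θ t.i * v) (slope θ t.i * hgt θ t.i + slope θ t.j * (v - hgt θ t.i))

/-- The same for the right side. -/
def Tile.right (θ : Fin n → ℝ) (t : Tile n) (v : ℝ) : ℝ :=
  min (slope θ t.j * v) (slope θ t.j * hgt θ t.j + slope θ t.i * (v - hgt θ t.j))

/-- Up to positive factors, the oblique coordinates are the horizontal offsets of `p` from the two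
lines through the top vertex. Bounds on `a` and `b` thus become linear inequalities. -/
theorem Tile.exists_coords (hθ : Admissible θ) (t : Tile n) (p : ℂ) :
    ∃ a b : ℝ, p = t.top + (a : ℂ) * dir θ t.i + (b : ℂ) * dir θ t.j ∧
      (p.re - t.top.re) - slope θ t.i * (t.top.im - p.im)
        = (slope θ t.j - slope θ t.i) * hgt θ t.j * b ∧
      slope θ t.j * (t.top.im - p.im) - (p.re - t.top.re)
        = (slope θ t.j - slope θ t.i) * hgt θ t.i * a := by
  have hi := hθ.hgt_pos t.i
  have hj := hθ.hgt_pos t.j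
  have hs : 0 < slope θ t.j - slope θ t.i := sub_pos.2 (hθ.slope_strictMono t.lt)
  have hs' := hs.ne'
  refine ⟨(slope θ t.j * (t.top.im - p.im) - (p.re - t.top.re)) / ((slope θ t.j - slope θ t.i) * hgt θ t.i),
    ((p.re - t.top.re) - slope θ t.i * (t.top.im - p.im)) / ((slope θ t.j - slope θ t.i) * hgt θ t.j),
    ?_, by field_simp, by field_simp⟩
  rw [Complex.ext_iff]
  simp only [Complex.add_re, Complex.add_im, Complex.re_ofReal_mul, Complex.im_ofReal_mul,
    hθ.dir_re, dir_im]
  constructor <;> field_simp <;> ring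

theorem Tile.coords (hθ : Admissible θ) (t : Tile n) {p : ℂ} {a b : ℝ}
    (h : p = t.top + (a : ℂ) * dir θ t.i + (b : ℂ) * dir θ t.j) :
    p.re - t.top.re = a * (slope θ t.i * hgt θ t.i) + b * (slope θ t.j * hgt θ t.j) ∧
      t.top.im - p.im = a * hgt θ t.i + b * hgt θ t.j := by
  subst h
  simp only [Complex.add_re, Complex.add_im, Complex.re_ofReal_mul, Complex.im_ofReal_mul,
    hθ.dir_re, dir_im]
  constructor <;> ring

theorem Tile.mem_carrier (hθ : Admissible θ) (t : Tile n) (p : ℂ) :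
    p ∈ t.carrier θ ↔ t.left θ (t.top.im - p.im) ≤ p.re - t.top.re ∧
      p.re - t.top.re ≤ t.right θ (t.top.im - p.im) := by
  have hi := hθ.hgt_pos t.i
  have hj := hθ.hgt_pos t.j
  have hs : 0 < slope θ t.j - slope θ t.i := sub_pos.2 (hθ.slope_strictMono t.lt)
  simp only [Tile.left, Tile.right, max_le_iff, le_min_iff]
  constructor
  · rintro ⟨a, ⟨ha0, ha1⟩, b, ⟨hb0, hb1⟩, h⟩
    obtain ⟨h1, h2⟩ := t.coords hθ h
    rw [h1, h2]
    have e1 := mul_nonneg (mul_pos hs hj).le hb0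
    have e2 := mul_nonneg (mul_pos hs hj).le (sub_nonneg.2 hb1)
    have e3 := mul_nonneg (mul_pos hs hi).le ha0
    have e4 := mul_nonneg (mul_pos hs hi).le (sub_nonneg.2 ha1)
    refine ⟨⟨?_, ?_⟩, ?_, ?_⟩ <;> linarith
  · rintro ⟨⟨h1, h2⟩, h3, h4⟩
    obtain ⟨a, b, h, hb, ha⟩ := t.exists_coords hθ p
    refine ⟨a, ⟨?_, ?_⟩, b, ⟨?_, ?_⟩, h⟩
    · exact nonneg_of_mul_nonneg_right (by linarith) (mul_pos hs hi)
    · refine le_of_mul_le_mul_left ?_ (mul_pos hs hi); linarith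
    · exact nonneg_of_mul_nonneg_right (by linarith) (mul_pos hs hj)
    · refine le_of_mul_le_mul_left ?_ (mul_pos hs hj); linarith

theorem Tile.mem_interior (hθ : Admissible θ) (t : Tile n) {p : ℂ}
    (h1 : t.left θ (t.top.im - p.im) < p.re - t.top.re)
    (h2 : p.re - t.top.re < t.right θ (t.top.im - p.im)) : p ∈ interior (t.carrier θ) := by
  rw [_root_.mem_interior]
  refine ⟨{q | t.left θ (t.top.im - q.im) < q.re - t.top.re} ∩
    {q | q.re - t.top.re < t.right θ (t.top.im - q.im)}, fun q hq => ?_, ?_, ⟨h1, h2⟩⟩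
  · exact (t.mem_carrier hθ q).2 ⟨le_of_lt hq.1, le_of_lt hq.2⟩
  · have hl : Continuous (t.left θ) := by unfold Tile.left; fun_prop
    have hr : Continuous (t.right θ) := by unfold Tile.right; fun_prop
    have hre := Complex.continuous_re
    have him := Complex.continuous_im
    refine (isOpen_lt ?_ ?_).inter (isOpen_lt ?_ ?_) <;> fun_prop

/-- Inside the range of depths of a tile, its left side is strictly to the left of its right side. -/
theorem Tile.left_lt_right (hθ : Admissible θ) (t : Tile n) {v : ℝ} (h0 : 0 < v)
    (h1 : v < hgt θ t.i + hgt θ t.j) : t.left θ v < t.right θ v := by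
  have hi := hθ.hgt_pos t.i
  have hj := hθ.hgt_pos t.j
  have hs : 0 < slope θ t.j - slope θ t.i := sub_pos.2 (hθ.slope_strictMono t.lt)
  simp only [Tile.left, Tile.right, max_lt_iff, lt_min_iff]
  have e1 := mul_pos hs h0
  have e2 := mul_pos hs hi
  have e3 := mul_pos hs hj
  have e4 := mul_pos hs (sub_pos.2 h1)
  refine ⟨⟨?_, ?_⟩, ?_, ?_⟩ <;> linarith

theorem Tile.depth_of_mem (hθ : Admissible θ) (t : Tile n) {p : ℂ} (hp : p ∈ t.carrier θ) :
    0 ≤ t.top.im - p.im ∧ t.top.im - p.im ≤ hgt θ t.i + hgt θ t.j := by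
  obtain ⟨a, ⟨ha0, ha1⟩, b, ⟨hb0, hb1⟩, h⟩ := hp
  have hi := hθ.hgt_pos t.i
  have hj := hθ.hgt_pos t.j
  rw [(t.coords hθ h).2]
  constructor <;> nlinarith

theorem Tile.left_eq_upper (hθ : Admissible θ) (t : Tile n) {v : ℝ} (h : v ≤ hgt θ t.i) :
    t.left θ v = slope θ t.i * v := by
  have hs : 0 < slope θ t.j - slope θ t.i := sub_pos.2 (hθ.slope_strictMono t.lt)
  rw [Tile.left, max_eq_left]
  nlinarith

theorem Tile.left_eq_lower (hθ : Admissible θ) (t : Tile n) {v : ℝ} (h : hgt θ t.i ≤ v) :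
    t.left θ v = slope θ t.i * hgt θ t.i + slope θ t.j * (v - hgt θ t.i) := by
  have hs : 0 < slope θ t.j - slope θ t.i := sub_pos.2 (hθ.slope_strictMono t.lt)
  rw [Tile.left, max_eq_right]
  nlinarith

theorem Tile.right_eq_upper (hθ : Admissible θ) (t : Tile n) {v : ℝ} (h : v ≤ hgt θ t.j) :
    t.right θ v = slope θ t.j * v := by
  have hs : 0 < slope θ t.j - slope θ t.i := sub_pos.2 (hθ.slope_strictMono t.lt)
  rw [Tile.right, min_eq_left]
  nlinarith

theorem Tile.right_eq_lower (hθ : Admissible θ) (t : Tile n) {v : ℝ} (h : hgt θ t.j ≤ v) :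
    t.right θ v = slope θ t.j * hgt θ t.j + slope θ t.i * (v - hgt θ t.j) := by
  have hs : 0 < slope θ t.j - slope θ t.i := sub_pos.2 (hθ.slope_strictMono t.lt)
  rw [Tile.right, min_eq_right]
  nlinarith

end

/-! ### From sweeps to tilings. -/

section

variable {n : ℕ} {θ : Fin n → ℝ}

section Corner

variable {σ : Perm (Fin n)} {m m' : Fin n}

theorem pathVertex_mul_swap (θ : Fin n → ℝ) (σ : Perm (Fin n)) (hm : m'.val = m.val + 1) {j : ℕ}
    (hj : j ≠ m'.val) : pathVertex θ (σ * swap m m') j = pathVertex θ σ j := by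
  refine pathVertex_congr θ fun v => ?_
  rw [mul_swap_symm_apply]
  simp only [swap_apply_def, Fin.ext_iff]
  split_ifs <;> omega

theorem depth_mul_swap (θ : Fin n → ℝ) (σ : Perm (Fin n)) (hm : m'.val = m.val + 1) {j : ℕ}
    (hj : j ≠ m'.val) : depth θ (σ * swap m m') j = depth θ σ j := by
  rw [depth, depth, pathVertex_mul_swap θ σ hm hj]

theorem abscissa_eq_left (hθ : Admissible θ) (hm : m'.val = m.val + 1) (h : σ m < σ m') {y : ℝ}
    (h0 : depth θ σ m.val ≤ y) (h1 : y ≤ depth θ σ m.val + (hgt θ (σ m) + hgt θ (σ m'))) :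
    abscissa θ σ y = (pathVertex θ σ m.val).re
      + (cornerTile θ σ m m' h).left θ (y - depth θ σ m.val) := by
  have hd : depth θ σ m'.val = depth θ σ m.val + hgt θ (σ m) := by rw [hm, depth_succ]
  rcases le_total (y - depth θ σ m.val) (hgt θ (σ m)) with hv | hv
  · rw [abscissa_edge hθ σ m h0 (by linarith), Tile.left_eq_upper hθ (cornerTile θ σ m m' h) hv]
    rfl
  · rw [abscissa_edge hθ σ m' (by linarith) (by linarith), Tile.left_eq_lower hθ (cornerTile θ σ m m' h) hv, hd, hm,
      pathVertex_succ, Complex.add_re, hθ.dir_re]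
    simp only [cornerTile]
    ring

theorem abscissa_eq_right (hθ : Admissible θ) (hm : m'.val = m.val + 1) (h : σ m < σ m') {y : ℝ}
    (h0 : depth θ σ m.val ≤ y) (h1 : y ≤ depth θ σ m.val + (hgt θ (σ m) + hgt θ (σ m'))) :
    abscissa θ (σ * swap m m') y = (pathVertex θ σ m.val).re
      + (cornerTile θ σ m m' h).right θ (y - depth θ σ m.val) := by
  have hne : m.val ≠ m'.val := by omega
  have e0 := depth_mul_swap θ σ hm hne
  have e1 : (σ * swap m m') m = σ m' := by simp
  have e2 : (σ * swap m m') m' = σ m := by simp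
  have hd : depth θ (σ * swap m m') m'.val = depth θ σ m.val + hgt θ (σ m') := by
    rw [hm, depth_succ, e0, e1]
  have hp : (pathVertex θ (σ * swap m m') m'.val).re
      = (pathVertex θ σ m.val).re + slope θ (σ m') * hgt θ (σ m') := by
    rw [hm, pathVertex_succ, e1, Complex.add_re, hθ.dir_re, pathVertex_mul_swap θ σ hm hne]
  rcases le_total (y - depth θ σ m.val) (hgt θ (σ m')) with hv | hv
  · rw [abscissa_edge hθ _ m (by rw [e0]; exact h0) (by rw [e0, e1]; linarith),
      Tile.right_eq_upper hθ (cornerTile θ σ m m' h) hv, e0, e1, pathVertex_mul_swap θ σ hm hne]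
    rfl
  · rw [abscissa_edge hθ _ m' (by linarith) (by rw [e2]; linarith), Tile.right_eq_lower hθ (cornerTile θ σ m m' h) hv,
      hd, hp, e2]
    simp only [cornerTile]
    ring

/-- Above the tile neither exchanged side contributes, below it both contribute fully; their order
is irrelevant. -/
theorem abscissa_mul_swap_of_notMem (hθ : Admissible θ) (hm : m'.val = m.val + 1) {y : ℝ}
    (hy : y ≤ depth θ σ m.val ∨ depth θ σ m.val + (hgt θ (σ m) + hgt θ (σ m')) ≤ y) :
    abscissa θ (σ * swap m m') y = abscissa θ σ y := by
  have hne : m ≠ m' := by rintro rfl; omega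
  have hne' : m.val ≠ m'.val := by omega
  have e0 := depth_mul_swap θ σ hm hne'
  have e1 : (σ * swap m m') m = σ m' := by simp
  have e2 : (σ * swap m m') m' = σ m := by simp
  have hd : depth θ σ m'.val = depth θ σ m.val + hgt θ (σ m) := by rw [hm, depth_succ]
  have hd' : depth θ (σ * swap m m') m'.val = depth θ σ m.val + hgt θ (σ m') := by
    rw [hm, depth_succ, e0, e1]
  have ha := hθ.hgt_pos (σ m)
  have hb := hθ.hgt_pos (σ m')
  have hsplit : ∀ τ : Perm (Fin n), abscissa θ τ y
      = slope θ (τ m) * clip (y - depth θ τ m.val) (hgt θ (τ m))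
      + (slope θ (τ m') * clip (y - depth θ τ m'.val) (hgt θ (τ m'))
      + ∑ l ∈ (Finset.univ.erase m).erase m',
          slope θ (τ l) * clip (y - depth θ τ l.val) (hgt θ (τ l))) := by
    intro τ
    rw [abscissa, ← Finset.add_sum_erase _ _ (Finset.mem_univ m),
      ← Finset.add_sum_erase _ _ (Finset.mem_erase.2 ⟨hne.symm, Finset.mem_univ m'⟩)]
  have hrest : ∑ l ∈ (Finset.univ.erase m).erase m', slope θ ((σ * swap m m') l) *
        clip (y - depth θ (σ * swap m m') l.val) (hgt θ ((σ * swap m m') l))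
      = ∑ l ∈ (Finset.univ.erase m).erase m',
          slope θ (σ l) * clip (y - depth θ σ l.val) (hgt θ (σ l)) := by
    refine Finset.sum_congr rfl fun l hl => ?_
    simp only [Finset.mem_erase] at hl
    rw [depth_mul_swap θ σ hm (fun e => hl.1 (Fin.ext e)), Perm.mul_apply,
      swap_apply_of_ne_of_ne hl.2.1 hl.1]
  rw [hsplit, hsplit σ, hrest, e0, e1, e2, hd, hd']
  have clip_neg : ∀ v u : ℝ, v ≤ 0 → clip v u = 0 := fun v u hv =>
    max_eq_left ((min_le_left _ _).trans hv)
  have clip_big : ∀ v u : ℝ, 0 < u → u ≤ v → clip v u = u := fun v u hu hv => by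
    rw [clip, min_eq_right hv, max_eq_right hu.le]
  rcases hy with hy | hy
  · rw [clip_neg _ _ (by linarith), clip_neg _ _ (by linarith), clip_neg _ _ (by linarith),
      clip_neg _ _ (by linarith)]
    ring
  · rw [clip_big _ _ hb (by linarith), clip_big _ _ ha (by linarith),
      clip_big _ _ ha (by linarith), clip_big _ _ hb (by linarith)]
    ring

theorem abscissa_lt_mul_swap (hθ : Admissible θ) (hm : m'.val = m.val + 1) (h : σ m < σ m') {y : ℝ}
    (h0 : depth θ σ m.val < y) (h1 : y < depth θ σ m.val + (hgt θ (σ m) + hgt θ (σ m'))) :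
    abscissa θ σ y < abscissa θ (σ * swap m m') y := by
  rw [abscissa_eq_left hθ hm h h0.le h1.le, abscissa_eq_right hθ hm h h0.le h1.le]
  have := (cornerTile θ σ m m' h).left_lt_right hθ (v := y - depth θ σ m.val) (by linarith)
    (by simp only [cornerTile]; linarith)
  linarith

theorem abscissa_le_mul_swap (hθ : Admissible θ) (hm : m'.val = m.val + 1) (h : σ m < σ m') (y : ℝ) :
    abscissa θ σ y ≤ abscissa θ (σ * swap m m') y := by
  by_cases hy : depth θ σ m.val < y ∧ y < depth θ σ m.val + (hgt θ (σ m) + hgt θ (σ m'))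
  · exact (abscissa_lt_mul_swap hθ hm h hy.1 hy.2).le
  · rw [abscissa_mul_swap_of_notMem hθ hm]
    by_contra! hc
    exact hy hc

theorem mem_cornerTile (hθ : Admissible θ) (hm : m'.val = m.val + 1) (h : σ m < σ m') (p : ℂ) :
    p ∈ (cornerTile θ σ m m' h).carrier θ ↔
      (depth θ σ m.val ≤ -p.im ∧ -p.im ≤ depth θ σ m.val + (hgt θ (σ m) + hgt θ (σ m'))) ∧
      abscissa θ σ (-p.im) ≤ p.re ∧ p.re ≤ abscissa θ (σ * swap m m') (-p.im) := by
  have e : (cornerTile θ σ m m' h).top.im - p.im = -p.im - depth θ σ m.val := by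
    simp only [cornerTile, depth]; ring
  have etop : (cornerTile θ σ m m' h).top = pathVertex θ σ m.val := rfl
  constructor
  · intro hp
    obtain ⟨h0, h1⟩ := Tile.depth_of_mem hθ _ hp
    obtain ⟨h2, h3⟩ := (Tile.mem_carrier hθ _ p).1 hp
    rw [e] at h0 h1 h2 h3
    have h0' : depth θ σ m.val ≤ -p.im := by linarith
    have h1' : -p.im ≤ depth θ σ m.val + (hgt θ (σ m) + hgt θ (σ m')) := by
      simp only [cornerTile] at h1; linarith
    rw [etop] at h2 h3
    rw [abscissa_eq_left hθ hm h h0' h1', abscissa_eq_right hθ hm h h0' h1']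
    exact ⟨⟨h0', h1'⟩, by linarith, by linarith⟩
  · rintro ⟨⟨h0, h1⟩, h2, h3⟩
    rw [abscissa_eq_left hθ hm h h0 h1] at h2
    rw [abscissa_eq_right hθ hm h h0 h1] at h3
    rw [Tile.mem_carrier hθ, e, etop]
    constructor <;> linarith

theorem mem_interior_cornerTile (hθ : Admissible θ) (hm : m'.val = m.val + 1) (h : σ m < σ m')
    {p : ℂ} (h1 : abscissa θ σ (-p.im) < p.re) (h2 : p.re < abscissa θ (σ * swap m m') (-p.im)) :
    p ∈ interior ((cornerTile θ σ m m' h).carrier θ) := by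
  have hy : depth θ σ m.val < -p.im ∧ -p.im < depth θ σ m.val + (hgt θ (σ m) + hgt θ (σ m')) := by
    by_contra hc
    rw [abscissa_mul_swap_of_notMem hθ hm] at h2
    · linarith
    · by_contra! hc'
      exact hc hc'
  have e : (cornerTile θ σ m m' h).top.im - p.im = -p.im - depth θ σ m.val := by
    simp only [cornerTile, depth]; ring
  rw [abscissa_eq_left hθ hm h hy.1.le hy.2.le] at h1
  rw [abscissa_eq_right hθ hm h hy.1.le hy.2.le] at h2
  refine Tile.mem_interior hθ _ ?_ ?_ <;> rw [e] <;> simp only [cornerTile] at * <;> linarith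

/-- The interior of a region to the right of a path is strictly to its right. -/
theorem abscissa_lt_of_mem_interior {τ : Perm (Fin n)} {S : Set ℂ}
    (hS : ∀ q ∈ S, abscissa θ τ (-q.im) ≤ q.re) {p : ℂ} (hp : p ∈ interior S) :
    abscissa θ τ (-p.im) < p.re := by
  obtain ⟨ε, hε, hball⟩ := Metric.isOpen_iff.1 isOpen_interior p hp
  have hq : p - ((ε / 2 : ℝ) : ℂ) ∈ S := by
    refine interior_subset (hball ?_)
    rw [Metric.mem_ball, dist_eq_norm, sub_sub_cancel_left, norm_neg, Complex.norm_real,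
      Real.norm_of_nonneg (by linarith)]
    linarith
  have := hS _ hq
  simp only [Complex.sub_im, Complex.ofReal_im, sub_zero, Complex.sub_re, Complex.ofReal_re] at this
  linarith

end Corner

namespace Peels

variable {w σ : Perm (Fin n)} {T : Set (Tile n)}

theorem abscissa_le (hθ : Admissible θ) (h : Peels θ w σ T) (y : ℝ) :
    abscissa θ σ y ≤ abscissa θ w y := by
  induction h with
  | refl => exact le_rfl
  | step σ m m' hm h T hT ih => exact (abscissa_le_mul_swap hθ hm h y).trans ih

theorem subset_region (hθ : Admissible θ) (h : Peels θ w σ T) {t : Tile n} (ht : t ∈ T) {p : ℂ}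
    (hp : p ∈ t.carrier θ) : (0 ≤ -p.im ∧ -p.im ≤ ∑ i, hgt θ i) ∧
      abscissa θ σ (-p.im) ≤ p.re ∧ p.re ≤ abscissa θ w (-p.im) := by
  induction h with
  | refl => exact ht.elim
  | step σ m m' hm h T hT ih =>
    rcases ht with rfl | ht
    · obtain ⟨⟨h0, h1⟩, h2, h3⟩ := (mem_cornerTile hθ hm h p).1 hp
      refine ⟨⟨?_, ?_⟩, h2, h3.trans (hT.abscissa_le hθ _)⟩
      · rw [← depth_zero θ σ]; exact (depth_mono hθ σ (Nat.zero_le _)).trans h0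
      · rw [← add_assoc, ← depth_succ, ← hm, ← depth_succ] at h1
        rw [← depth_card θ σ]
        exact h1.trans (depth_mono hθ σ m'.isLt)
    · obtain ⟨h0, h2, h3⟩ := ih ht
      exact ⟨h0, (abscissa_le_mul_swap hθ hm h _).trans h2, h3⟩

theorem exists_mem_of_lt (hθ : Admissible θ) (h : Peels θ w σ T) {p : ℂ}
    (h1 : abscissa θ σ (-p.im) < p.re) (h2 : p.re ≤ abscissa θ w (-p.im)) :
    ∃ t ∈ T, p ∈ t.carrier θ := by
  induction h with
  | refl => exact absurd h1 h2.not_gt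
  | step σ m m' hm h T hT ih =>
    by_cases hp : abscissa θ (σ * swap m m') (-p.im) < p.re
    · obtain ⟨t, ht, htp⟩ := ih hp
      exact ⟨t, Set.mem_insert_of_mem _ ht, htp⟩
    · push Not at hp
      refine ⟨_, Set.mem_insert _ _, (mem_cornerTile hθ hm h p).2 ⟨?_, h1.le, hp⟩⟩
      by_contra hc
      rw [abscissa_mul_swap_of_notMem hθ hm] at hp
      · linarith
      · by_contra! hc'
        exact hc ⟨hc'.1.le, hc'.2.le⟩

theorem disjoint_interior (hθ : Admissible θ) (h : Peels θ w σ T) {s t : Tile n} (hs : s ∈ T)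
    (ht : t ∈ T) (hst : s ≠ t) : Disjoint (interior (s.carrier θ)) (interior (t.carrier θ)) := by
  induction h with
  | refl => exact hs.elim
  | step σ m m' hm h T hT ih =>
    -- The corner tile lies weakly to the left of the new path, while interiors of later tiles lie
    -- strictly to its right.
    have key : ∀ s ∈ T, Disjoint (interior ((cornerTile θ σ m m' h).carrier θ))
        (interior (s.carrier θ)) := by
      intro s hs
      rw [Set.disjoint_left]
      intro p hp hps
      have h1 := ((mem_cornerTile hθ hm h p).1 (interior_subset hp)).2.2
      have h2 := abscissa_lt_of_mem_interior (fun q hq => (hT.subset_region hθ hs hq).2.1) hps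
      linarith
    rcases hs with rfl | hs <;> rcases ht with rfl | ht
    · exact absurd rfl hst
    · exact key t ht
    · exact (key s hs).symm
    · exact ih hs ht

/-- A side of the path `σ` is crossed, or it belongs to the path `w` as well. -/
theorem pathEdge_subset_or (hθ : Admissible θ) (h : Peels θ w σ T) (l : Fin n) :
    pathEdge θ σ l ⊆ (⋃ t ∈ T, t.carrier θ) ∨
      ∀ v, w.symm v < w.symm (σ l) ↔ σ.symm v < l := by
  induction h with
  | refl => right; intro v; simp
  | step σ m m' hm h T hT ih =>
    have ha := hθ.hgt_pos (σ m)
    have hb := hθ.hgt_pos (σ m')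
    have hd : depth θ σ m'.val = depth θ σ m.val + hgt θ (σ m) := by rw [hm, depth_succ]
    by_cases hl : l = m ∨ l = m'
    · left
      intro p hp
      rw [Set.mem_iUnion₂]
      refine ⟨_, Set.mem_insert _ _, (mem_cornerTile hθ hm h p).2 ?_⟩
      obtain ⟨h0, h1, h2⟩ := (mem_pathEdge hθ σ l p).1 hp
      rw [← abscissa_edge hθ σ l h0 h1] at h2
      refine ⟨?_, h2.ge, h2.trans_le (abscissa_le_mul_swap hθ hm h _)⟩
      rcases hl with rfl | rfl
      · constructor <;> linarith
      · constructor <;> linarith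
    · push Not at hl
      have e : (σ * swap m m') l = σ l := by
        rw [Perm.mul_apply, swap_apply_of_ne_of_ne hl.1 hl.2]
      have hlm' : l.val ≠ m'.val := fun e => hl.2 (Fin.ext e)
      have hlm : l.val + 1 ≠ m'.val := fun e => hl.1 (Fin.ext (by omega))
      rcases ih with ih | ih
      · left
        rw [pathEdge, pathVertex_mul_swap θ σ hm hlm', pathVertex_mul_swap θ σ hm hlm] at ih
        exact ih.trans (Set.biUnion_subset_biUnion_left (Set.subset_insert _ _))
      · right
        intro v
        rw [← e, ih v, mul_swap_symm_apply]
        simp only [swap_apply_def, Fin.ext_iff, Fin.lt_def] at *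
        split_ifs <;> omega

/-- An uncrossed side `l` would have the same labels before it in `w` as on the left, namely the
smaller ones; this contradicts full support. -/
theorem leftEdge_subset (hθ : Admissible θ) (hn : 2 ≤ n) (hw : FullySupported w)
    (h : Peels θ w 1 T) (l : Fin n) : leftEdge θ l ⊆ ⋃ t ∈ T, t.carrier θ := by
  refine (h.pathEdge_subset_or hθ l).resolve_right fun hl => ?_
  have hl' : ∀ v, w.symm v < w.symm l ↔ v < l := hl
  have hcard : (w.symm l).val = l.val := by
    have h1 : (Finset.univ.filter (fun p => p < w.symm l)).card
        = (Finset.univ.filter (fun p => p < l)).card := by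
      refine Finset.card_bij (fun p _ => w p) ?_ (fun a _ b _ hab => w.injective hab) ?_
      · intro a ha
        simpa [← hl'] using ha
      · intro b hb
        exact ⟨w.symm b, by simpa [hl'] using hb, by simp⟩
    simpa [Finset.filter_gt_eq_Iio] using h1
  have hwl : w l = l := by
    rw [← Equiv.eq_symm_apply]
    exact Fin.ext hcard.symm
  -- For the first label no label is smaller, so `r = 1` is used instead; this needs `2 ≤ n`.
  rcases Nat.eq_zero_or_pos l.val with h0 | h0
  · refine hw 1 le_rfl (by omega) ?_
    have : {i : Fin n | i.val < 1} = {l} := by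
      ext i
      simp only [Set.mem_ofPred_eq, Set.mem_singleton_iff, Fin.ext_iff]
      omega
    rw [this, Set.image_singleton, hwl]
  · refine hw l.val h0 l.isLt ?_
    ext v
    simp only [Set.mem_image, Set.mem_ofPred_eq]
    constructor
    · rintro ⟨p, hp, rfl⟩
      refine (hl' _).1 ?_
      rw [symm_apply_apply, Fin.lt_def, hcard]
      exact hp
    · intro hv
      refine ⟨w.symm v, ?_, by simp⟩
      rw [← hcard]
      exact (hl' v).2 hv

theorem isRhombicTiling (hθ : Admissible θ) (hn : 2 ≤ n) (hw : FullySupported w)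
    (h : Peels θ w 1 T) : IsRhombicTiling θ w h.finite.toFinset where
  cover := by
    ext p
    rw [mem_polygon hθ w (by omega)]
    simp only [Set.Finite.mem_toFinset]
    constructor
    · intro hp
      obtain ⟨t, ht, htp⟩ := Set.mem_iUnion₂.1 hp
      exact h.subset_region hθ ht htp
    · rintro ⟨h0, h1, h2⟩
      rcases h1.eq_or_lt with h1 | h1
      · have : p ∈ ⋃ m, pathEdge θ 1 m := by
          rw [mem_iUnion_pathEdge hθ 1 (by omega)]
          exact ⟨h0, h1.symm⟩
        obtain ⟨l, hl⟩ := Set.mem_iUnion.1 this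
        exact h.leftEdge_subset hθ hn hw l hl
      · obtain ⟨t, ht, htp⟩ := h.exists_mem_of_lt hθ h1 h2
        exact Set.mem_iUnion₂.2 ⟨t, ht, htp⟩
  disjoint s hs t ht hst :=
    h.disjoint_interior hθ (by simpa using hs) (by simpa using ht) hst

end Peels

end

/-! ### From tilings to sweeps: every partial tiling has a removable corner tile. -/

section

variable {n : ℕ} {θ : Fin n → ℝ} {w σ : Perm (Fin n)} {T : Set (Tile n)}

theorem Tile.isClosed_carrier (hθ : Admissible θ) (t : Tile n) : IsClosed (t.carrier θ) := by
  have hl : Continuous (t.left θ) := by unfold Tile.left; fun_prop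
  have hr : Continuous (t.right θ) := by unfold Tile.right; fun_prop
  have hre := Complex.continuous_re
  have him := Complex.continuous_im
  have : t.carrier θ = {p | t.left θ (t.top.im - p.im) ≤ p.re - t.top.re} ∩
      {p | p.re - t.top.re ≤ t.right θ (t.top.im - p.im)} := by
    ext p; exact t.mem_carrier hθ p
  rw [this]
  refine (isClosed_le ?_ ?_).inter (isClosed_le ?_ ?_) <;> fun_prop

/-- `T` tiles the region between the path `σ` and the path `w`, apart from degenerate parts. -/
structure IsPartialTiling (θ : Fin n → ℝ) (w σ : Perm (Fin n)) (T : Set (Tile n)) : Prop where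
  finite : T.Finite
  le : ∀ y, abscissa θ σ y ≤ abscissa θ w y
  subset : ∀ t ∈ T, ∀ p ∈ t.carrier θ, (0 ≤ -p.im ∧ -p.im ≤ ∑ i, hgt θ i) ∧
    abscissa θ σ (-p.im) ≤ p.re ∧ p.re ≤ abscissa θ w (-p.im)
  cover : ∀ p : ℂ, abscissa θ σ (-p.im) < p.re → p.re < abscissa θ w (-p.im) →
    ∃ t ∈ T, p ∈ t.carrier θ
  disjoint : ∀ s ∈ T, ∀ t ∈ T, s ≠ t → Disjoint (interior (s.carrier θ)) (interior (t.carrier θ))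

/-- The depths at which the path `σ` runs along the upper left edge of a tile. -/
def upperTouch (θ : Fin n → ℝ) (σ : Perm (Fin n)) (t : Tile n) : Set ℝ :=
  {y | (0 < y + t.top.im ∧ y + t.top.im < hgt θ t.i) ∧
    abscissa θ σ y = t.top.re + slope θ t.i * (y + t.top.im) ∧
    depth θ σ (σ.symm t.i).val < y ∧ y < depth θ σ (σ.symm t.i).val + hgt θ t.i}

/-- The depths at which the path `σ` runs along the lower left edge of a tile. -/
def lowerTouch (θ : Fin n → ℝ) (σ : Perm (Fin n)) (t : Tile n) : Set ℝ :=
  {y | (hgt θ t.i < y + t.top.im ∧ y + t.top.im < hgt θ t.i + hgt θ t.j) ∧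
    abscissa θ σ y =
      t.top.re + (slope θ t.i * hgt θ t.i + slope θ t.j * (y + t.top.im - hgt θ t.i)) ∧
    depth θ σ (σ.symm t.j).val < y ∧ y < depth θ σ (σ.symm t.j).val + hgt θ t.j}

theorem of_mem_closure_upperTouch {t : Tile n} {y : ℝ} (hy : y ∈ closure (upperTouch θ σ t)) :
    (0 ≤ y + t.top.im ∧ y + t.top.im ≤ hgt θ t.i) ∧
    abscissa θ σ y = t.top.re + slope θ t.i * (y + t.top.im) ∧
    depth θ σ (σ.symm t.i).val ≤ y ∧ y ≤ depth θ σ (σ.symm t.i).val + hgt θ t.i := by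
  have hX := continuous_abscissa θ σ
  have hc : IsClosed {y | (0 ≤ y + t.top.im ∧ y + t.top.im ≤ hgt θ t.i) ∧
      abscissa θ σ y = t.top.re + slope θ t.i * (y + t.top.im) ∧
      depth θ σ (σ.symm t.i).val ≤ y ∧ y ≤ depth θ σ (σ.symm t.i).val + hgt θ t.i} := by
    simp only [Set.ofPred_and]
    refine ((isClosed_le ?_ ?_).inter (isClosed_le ?_ ?_)).inter
      ((isClosed_eq ?_ ?_).inter ((isClosed_le ?_ ?_).inter (isClosed_le ?_ ?_))) <;> fun_prop
  refine (closure_minimal (s := upperTouch θ σ t) ?_ hc) hy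
  exact fun y hy => ⟨⟨hy.1.1.le, hy.1.2.le⟩, hy.2.1, hy.2.2.1.le, hy.2.2.2.le⟩

theorem of_mem_closure_lowerTouch {t : Tile n} {y : ℝ} (hy : y ∈ closure (lowerTouch θ σ t)) :
    (hgt θ t.i ≤ y + t.top.im ∧ y + t.top.im ≤ hgt θ t.i + hgt θ t.j) ∧
    abscissa θ σ y =
      t.top.re + (slope θ t.i * hgt θ t.i + slope θ t.j * (y + t.top.im - hgt θ t.i)) ∧
    depth θ σ (σ.symm t.j).val ≤ y ∧ y ≤ depth θ σ (σ.symm t.j).val + hgt θ t.j := by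
  have hX := continuous_abscissa θ σ
  have hc : IsClosed {y | (hgt θ t.i ≤ y + t.top.im ∧ y + t.top.im ≤ hgt θ t.i + hgt θ t.j) ∧
      abscissa θ σ y =
        t.top.re + (slope θ t.i * hgt θ t.i + slope θ t.j * (y + t.top.im - hgt θ t.i)) ∧
      depth θ σ (σ.symm t.j).val ≤ y ∧ y ≤ depth θ σ (σ.symm t.j).val + hgt θ t.j} := by
    simp only [Set.ofPred_and]
    refine ((isClosed_le ?_ ?_).inter (isClosed_le ?_ ?_)).inter
      ((isClosed_eq ?_ ?_).inter ((isClosed_le ?_ ?_).inter (isClosed_le ?_ ?_))) <;> fun_prop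
  refine (closure_minimal (s := lowerTouch θ σ t) ?_ hc) hy
  exact fun y hy => ⟨⟨hy.1.1.le, hy.1.2.le⟩, hy.2.1, hy.2.2.1.le, hy.2.2.2.le⟩

theorem exists_notMem_of_finite {E : Set ℝ} (hE : E.Finite) {a b : ℝ} (hab : a < b) :
    ∃ y, a < y ∧ y < b ∧ y ∉ E := by
  obtain ⟨y, hy, hyE⟩ := (Set.Ioo_infinite hab).exists_notMem_finite hE
  exact ⟨y, hy.1, hy.2, hyE⟩

/-- The slope of a side of a path that touches a line from the left is that of the line. -/
theorem edge_label_eq_of_touch (hθ : Admissible θ) {m i : Fin n} {a y δ : ℝ} (hδ : 0 < δ)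
    (h0 : depth θ σ m.val < y) (h1 : y < depth θ σ m.val + hgt θ (σ m))
    (hle : ∀ z, |z - y| < δ → abscissa θ σ z ≤ a + slope θ i * (z - y)) (heq : abscissa θ σ y = a) :
    σ m = i := by
  -- The depths `y + ε` and `y - ε` stay on the same side of the path; they give the two
  -- inequalities between the slopes.
  obtain ⟨ε, hε, hε'⟩ : ∃ ε, 0 < ε ∧ ε < min δ (min (y - depth θ σ m.val)
      (depth θ σ m.val + hgt θ (σ m) - y)) :=
    exists_between (lt_min hδ (lt_min (by linarith) (by linarith)))
  simp only [lt_min_iff] at hε'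
  obtain ⟨e1, e2, e3⟩ := hε'
  have h2 := hle (y + ε) (by rw [add_sub_cancel_left, abs_of_pos hε]; exact e1)
  have h3 := hle (y - ε) (by rw [sub_sub_cancel_left, abs_neg, abs_of_pos hε]; exact e1)
  rw [abscissa_edge hθ σ m h0.le h1.le] at heq
  rw [abscissa_edge hθ σ m (by linarith) (by linarith)] at h2 h3
  apply hθ.slope_strictMono.injective
  have h4 : slope θ (σ m) * ε ≤ slope θ i * ε := by linarith
  have h5 : slope θ i * ε ≤ slope θ (σ m) * ε := by linarith
  exact mul_right_cancel₀ hε.ne' (le_antisymm h4 h5)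

namespace IsPartialTiling

theorem le_left (hθ : Admissible θ) (h : IsPartialTiling θ w σ T) {t : Tile n} (ht : t ∈ T) {y : ℝ}
    (h0 : 0 < y + t.top.im) (h1 : y + t.top.im < hgt θ t.i + hgt θ t.j) :
    abscissa θ σ y ≤ t.top.re + t.left θ (y + t.top.im) := by
  have hlt := t.left_lt_right hθ h0 h1
  have e : t.top.im - -y = y + t.top.im := by ring
  have := (h.subset t ht ⟨t.top.re + t.left θ (y + t.top.im), -y⟩ (by
    rw [t.mem_carrier hθ]
    simp only [e, add_sub_cancel_left]
    exact ⟨le_rfl, hlt.le⟩)).2.1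
  simpa using this

theorem right_le (hθ : Admissible θ) (h : IsPartialTiling θ w σ T) {t : Tile n} (ht : t ∈ T) {y : ℝ}
    (h0 : 0 < y + t.top.im) (h1 : y + t.top.im < hgt θ t.i + hgt θ t.j) :
    t.top.re + t.right θ (y + t.top.im) ≤ abscissa θ w y := by
  have hlt := t.left_lt_right hθ h0 h1
  have e : t.top.im - -y = y + t.top.im := by ring
  have := (h.subset t ht ⟨t.top.re + t.right θ (y + t.top.im), -y⟩ (by
    rw [t.mem_carrier hθ]
    simp only [e, add_sub_cancel_left]
    exact ⟨hlt.le, le_rfl⟩)).2.2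
  simpa using this

theorem lt_of_mem (hθ : Admissible θ) (h : IsPartialTiling θ w σ T) {t : Tile n} (ht : t ∈ T) {y : ℝ}
    (h0 : 0 < y + t.top.im) (h1 : y + t.top.im < hgt θ t.i + hgt θ t.j) :
    abscissa θ σ y < abscissa θ w y := by
  have h2 := h.le_left hθ ht h0 h1
  have h3 := h.right_le hθ ht h0 h1
  have := t.left_lt_right hθ h0 h1
  linarith

/-- Tiles that touch the path `σ` at the same depth are equal. -/
theorem eq_of_touch (hθ : Admissible θ) (h : IsPartialTiling θ w σ T) {s t : Tile n} (hs : s ∈ T)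
    (ht : t ∈ T) {y : ℝ} (hs0 : 0 < y + s.top.im) (hs1 : y + s.top.im < hgt θ s.i + hgt θ s.j)
    (ht0 : 0 < y + t.top.im) (ht1 : y + t.top.im < hgt θ t.i + hgt θ t.j)
    (hsy : abscissa θ σ y = s.top.re + s.left θ (y + s.top.im))
    (hty : abscissa θ σ y = t.top.re + t.left θ (y + t.top.im)) : s = t := by
  by_contra hst
  have hls := s.left_lt_right hθ hs0 hs1
  have hlt := t.left_lt_right hθ ht0 ht1
  obtain ⟨x, hx, hx'⟩ : ∃ x, abscissa θ σ y < x ∧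
      x < min (s.top.re + s.right θ (y + s.top.im)) (t.top.re + t.right θ (y + t.top.im)) :=
    exists_between (lt_min (by linarith) (by linarith))
  rw [lt_min_iff] at hx'
  have es : s.top.im - -y = y + s.top.im := by ring
  have et : t.top.im - -y = y + t.top.im := by ring
  refine Set.disjoint_left.1 (h.disjoint s hs t ht hst)
    (s.mem_interior hθ (p := ⟨x, -y⟩) ?_ ?_) (t.mem_interior hθ ?_ ?_) <;> simp only [es, et] <;> linarith

/-- With finitely many exceptions, there is a tile at each depth at which the path `σ` is to the left
of the path `w`. -/
theorem exists_touch (hθ : Admissible θ) (hn : 0 < n) (h : IsPartialTiling θ w σ T) :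
    ∃ E : Set ℝ, E.Finite ∧ ∀ y, y ∉ E → abscissa θ σ y < abscissa θ w y →
      ∃ t ∈ T, y ∈ upperTouch θ σ t ∨ y ∈ lowerTouch θ σ t := by
  -- The exceptions are the depths of the tile corners and of the vertices of the path.
  refine ⟨(⋃ t ∈ T, {-t.top.im, -t.top.im + hgt θ t.i, -t.top.im + (hgt θ t.i + hgt θ t.j)}) ∪
    ⋃ m : Fin n, {depth θ σ m.val, depth θ σ m.val + hgt θ (σ m)},
    (h.finite.biUnion fun t _ => Set.toFinite _).union (Set.finite_iUnion fun m => Set.toFinite _),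
    fun y hyE hy => ?_⟩
  simp only [Set.mem_union, Set.mem_iUnion, Set.mem_insert_iff, Set.mem_singleton_iff, not_or,
    not_exists] at hyE
  obtain ⟨hyT, hyV⟩ := hyE
  -- Only points strictly between the paths are known to be covered; the point on `σ` is a limit of
  -- these, and finitely many closed tiles have a closed union.
  have hp : (⟨abscissa θ σ y, -y⟩ : ℂ) ∈ ⋃ t ∈ T, t.carrier θ := by
    have hclosed : IsClosed (⋃ t ∈ T, t.carrier θ) :=
      h.finite.isClosed_biUnion fun t _ => t.isClosed_carrier hθ
    have hx : abscissa θ σ y ∈ closure (Set.Ioo (abscissa θ σ y) (abscissa θ w y)) := by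
      rw [closure_Ioo hy.ne]
      exact ⟨le_rfl, hy.le⟩
    have hcont : Continuous fun x : ℝ => (⟨x, -y⟩ : ℂ) := by
      have : (fun x : ℝ => (⟨x, -y⟩ : ℂ)) = fun x : ℝ => (x : ℂ) + ((-y : ℝ) : ℂ) * Complex.I := by
        funext x; exact Complex.mk_eq_add_mul_I _ _
      rw [this]
      fun_prop
    refine closure_minimal ?_ (hclosed.preimage hcont) hx
    intro x hx
    obtain ⟨t, ht, htx⟩ := h.cover ⟨x, -y⟩ (by simpa using hx.1) (by simpa using hx.2)
    exact Set.mem_iUnion₂.2 ⟨t, ht, htx⟩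
  obtain ⟨t, ht, htp⟩ := Set.mem_iUnion₂.1 hp
  have e : t.top.im - -y = y + t.top.im := by ring
  obtain ⟨h0, h1⟩ := t.depth_of_mem hθ htp
  have hrange := (h.subset t ht _ htp).1
  simp only [neg_neg] at hrange
  obtain ⟨n1, n2, n3⟩ := hyT t ht
  simp only [e] at h0 h1
  have h0' : 0 < y + t.top.im := lt_of_le_of_ne h0 fun e => n1 (by linarith)
  have h1' : y + t.top.im < hgt θ t.i + hgt θ t.j := lt_of_le_of_ne h1 fun e => n3 (by linarith)
  have heq : abscissa θ σ y = t.top.re + t.left θ (y + t.top.im) := by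
    refine le_antisymm (h.le_left hθ ht h0' h1') ?_
    have := ((t.mem_carrier hθ _).1 htp).1
    simp only [e] at this
    linarith
  obtain ⟨m, hm0, hm1⟩ := exists_edge σ hn hrange.1 hrange.2
  obtain ⟨v1, v2⟩ := hyV m
  have hm0' := lt_of_le_of_ne hm0 (Ne.symm v1)
  have hm1' := lt_of_le_of_ne hm1 v2
  refine ⟨t, ht, ?_⟩
  rcases lt_or_ge (y + t.top.im) (hgt θ t.i) with hv | hv
  · left
    rw [t.left_eq_upper hθ hv.le] at heq
    have hlab : σ m = t.i := by
      refine edge_label_eq_of_touch hθ (lt_min h0' (sub_pos.2 hv)) hm0' hm1' (fun z hz => ?_) heq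
      rw [lt_min_iff, abs_lt, abs_lt] at hz
      have hj := hθ.hgt_pos t.j
      have := h.le_left hθ ht (y := z) (by linarith) (by linarith)
      rw [t.left_eq_upper hθ (by linarith)] at this
      linarith
    have hm : σ.symm t.i = m := by rw [← hlab, symm_apply_apply]
    refine ⟨⟨h0', hv⟩, heq, ?_, ?_⟩
    · rwa [hm]
    · rwa [hm, ← hlab]
  · right
    have hv' : hgt θ t.i < y + t.top.im := lt_of_le_of_ne hv fun e => n2 (by linarith)
    rw [t.left_eq_lower hθ hv] at heq
    have hlab : σ m = t.j := by
      refine edge_label_eq_of_touch hθ (lt_min (sub_pos.2 hv') (sub_pos.2 h1')) hm0' hm1'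
        (fun z hz => ?_) heq
      rw [lt_min_iff, abs_lt, abs_lt] at hz
      have hi := hθ.hgt_pos t.i
      have := h.le_left hθ ht (y := z) (by linarith) (by linarith)
      rw [t.left_eq_lower hθ (by linarith)] at this
      linarith
    have hm : σ.symm t.j = m := by rw [← hlab, symm_apply_apply]
    refine ⟨⟨hv', h1'⟩, heq, ?_, ?_⟩
    · rwa [hm]
    · rwa [hm, ← hlab]

theorem exists_nhds_abscissa_lt {y : ℝ} (hy : abscissa θ σ y < abscissa θ w y) :
    ∃ δ > 0, ∀ z, |z - y| < δ → abscissa θ σ z < abscissa θ w z := by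
  have ho : IsOpen {z | abscissa θ σ z < abscissa θ w z} :=
    isOpen_lt (continuous_abscissa θ σ) (continuous_abscissa θ w)
  obtain ⟨δ, hδ, hb⟩ := Metric.isOpen_iff.1 ho y hy
  exact ⟨δ, hδ, fun z hz => hb (by rwa [Metric.mem_ball, Real.dist_eq])⟩

/-- Suppose only upper edges were touched. At the supremum of the touched depths the tile still
extends further down, so `σ` is still strictly left of `w` and some slightly greater depth is
touched as well. -/
theorem exists_lowerTouch (hθ : Admissible θ) (hn : 0 < n) (h : IsPartialTiling θ w σ T)
    (hT : T.Nonempty) : (⋃ t ∈ T, lowerTouch θ σ t).Nonempty := by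
  obtain ⟨E, hE, htouch⟩ := h.exists_touch hθ hn
  by_contra hU
  have hno : ∀ t ∈ T, ∀ y, y ∉ lowerTouch θ σ t := fun t ht y hy =>
    hU ⟨y, Set.mem_iUnion₂.2 ⟨t, ht, hy⟩⟩
  have htouch' : ∀ y, y ∉ E → abscissa θ σ y < abscissa θ w y → y ∈ ⋃ t ∈ T, upperTouch θ σ t := by
    intro y hyE hy
    obtain ⟨t, ht, hyt⟩ := htouch y hyE hy
    exact Set.mem_iUnion₂.2 ⟨t, ht, hyt.resolve_right (hno t ht y)⟩
  have hne : (⋃ t ∈ T, upperTouch θ σ t).Nonempty := by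
    obtain ⟨t, ht⟩ := hT
    have hi := hθ.hgt_pos t.i
    have hj := hθ.hgt_pos t.j
    obtain ⟨y, hy0, hy1, hyE⟩ := exists_notMem_of_finite hE
      (show -t.top.im < -t.top.im + (hgt θ t.i + hgt θ t.j) by linarith)
    exact ⟨y, htouch' y hyE (h.lt_of_mem hθ ht (by linarith) (by linarith))⟩
  have hbdd : BddAbove (⋃ t ∈ T, upperTouch θ σ t) := by
    refine ⟨∑ i, hgt θ i, fun y hy => ?_⟩
    obtain ⟨t, ht, hyt⟩ := Set.mem_iUnion₂.1 hy
    have h2 := depth_succ θ σ (σ.symm t.i)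
    rw [apply_symm_apply] at h2
    have h3 := depth_mono hθ σ (show (σ.symm t.i).val + 1 ≤ n from (σ.symm t.i).isLt)
    rw [depth_card] at h3
    linarith [hyt.2.2.2]
  have hcl := csSup_mem_closure hne hbdd
  set y := sSup (⋃ t ∈ T, upperTouch θ σ t) with hy
  rw [h.finite.closure_biUnion] at hcl
  obtain ⟨t, ht, hyt⟩ := Set.mem_iUnion₂.1 hcl
  obtain ⟨⟨-, h1⟩, -, -⟩ := of_mem_closure_upperTouch hyt
  obtain ⟨y0, hy0⟩ := closure_nonempty_iff.1 ⟨y, hyt⟩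
  have hle : y0 ≤ y := le_csSup hbdd (Set.mem_iUnion₂.2 ⟨t, ht, hy0⟩)
  have hlt := h.lt_of_mem hθ ht (y := y) (by linarith [hy0.1.1]) (by linarith [hθ.hgt_pos t.j])
  obtain ⟨δ, hδ, hball⟩ := exists_nhds_abscissa_lt hlt
  obtain ⟨z, hz0, hz1, hzE⟩ := exists_notMem_of_finite hE (show y < y + δ by linarith)
  have hz := htouch' z hzE (hball z (by rw [abs_lt]; constructor <;> linarith))
  exact absurd (le_csSup hbdd hz) (not_le.2 hz0)

/-- A partial tiling has a tile in a corner of its left boundary path. -/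
theorem exists_cornerTile (hθ : Admissible θ) (hn : 0 < n) (h : IsPartialTiling θ w σ T)
    (hT : T.Nonempty) :
    ∃ (m m' : Fin n) (_ : m'.val = m.val + 1) (hlt : σ m < σ m'), cornerTile θ σ m m' hlt ∈ T := by
  obtain ⟨E, hE, htouch⟩ := h.exists_touch hθ hn
  have hne := h.exists_lowerTouch hθ hn hT
  have hbdd : BddBelow (⋃ t ∈ T, lowerTouch θ σ t) := by
    refine ⟨0, fun y hy => ?_⟩
    obtain ⟨t, ht, hyt⟩ := Set.mem_iUnion₂.1 hy
    have h3 := depth_mono hθ σ (Nat.zero_le (σ.symm t.j).val)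
    rw [depth_zero] at h3
    linarith [hyt.2.2.1]
  have hcl := csInf_mem_closure hne hbdd
  set y := sInf (⋃ t ∈ T, lowerTouch θ σ t) with hy
  rw [h.finite.closure_biUnion] at hcl
  obtain ⟨s, hs, hys⟩ := Set.mem_iUnion₂.1 hcl
  obtain ⟨⟨hs0, -⟩, hsX, hsd, -⟩ := of_mem_closure_lowerTouch hys
  obtain ⟨y0, hy0⟩ := closure_nonempty_iff.1 ⟨y, hys⟩
  have hle : y ≤ y0 := csInf_le hbdd (Set.mem_iUnion₂.2 ⟨s, hs, hy0⟩)
  have hsi := hθ.hgt_pos s.i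
  have hs1 : y + s.top.im < hgt θ s.i + hgt θ s.j := by linarith [hy0.1.2]
  have hsd' : y < depth θ σ (σ.symm s.j).val + hgt θ s.j := by linarith [hy0.2.2.2]
  obtain ⟨δ, hδ, hball⟩ := exists_nhds_abscissa_lt (h.lt_of_mem hθ hs (by linarith) hs1)
  -- By minimality of `y`, only upper edges are touched just above it. Intersecting with `Set.Iio y`
  -- later supplies a touch strictly above `y`, hence strict bounds at `y`.
  have hcl' : y ∈ closure (⋃ t ∈ T, upperTouch θ σ t ∩ Set.Iio y) := by
    rw [Metric.mem_closure_iff]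
    intro ε hε
    obtain ⟨z, hz0, hz1, hzE⟩ := exists_notMem_of_finite hE
      (show y - min δ ε < y by linarith [lt_min hδ hε])
    have hzδ : y - z < δ := by linarith [min_le_left δ ε]
    have hzε : y - z < ε := by linarith [min_le_right δ ε]
    obtain ⟨t, ht, hzt⟩ := htouch z hzE (hball z (by rw [abs_lt]; constructor <;> linarith))
    refine ⟨z, Set.mem_iUnion₂.2 ⟨t, ht, hzt.resolve_right fun hzt => ?_, hz1⟩, ?_⟩
    · exact absurd (csInf_le hbdd (Set.mem_iUnion₂.2 ⟨t, ht, hzt⟩)) (not_le.2 hz1)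
    · rw [Real.dist_eq, abs_lt]; constructor <;> linarith
  rw [h.finite.closure_biUnion] at hcl'
  obtain ⟨t, ht, hyt⟩ := Set.mem_iUnion₂.1 hcl'
  obtain ⟨⟨-, ht1⟩, htX, -, htd⟩ :=
    of_mem_closure_upperTouch (closure_mono Set.inter_subset_left hyt)
  obtain ⟨y1, hy1, hy1'⟩ := closure_nonempty_iff.1 ⟨y, hyt⟩
  have hy1' : y1 < y := hy1'
  have ht0 : 0 < y + t.top.im := by linarith [hy1.1.1]
  have htd' : depth θ σ (σ.symm t.i).val < y := by linarith [hy1.2.2.1]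
  have hst : s = t := by
    refine h.eq_of_touch hθ hs ht (y := y) (by linarith) hs1 ht0 (by linarith [hθ.hgt_pos t.j]) ?_ ?_
    · rw [hsX, s.left_eq_lower hθ hs0]
    · rw [htX, t.left_eq_upper hθ ht1]
  subst hst
  -- So `y` is the depth of the left corner of `s`, where the sides of `σ` labeled `s.i` and `s.j`
  -- must meet; any side between them would have positive height.
  have hv : y + s.top.im = hgt θ s.i := le_antisymm ht1 hs0
  set m := σ.symm s.i with hm
  set m' := σ.symm s.j with hm'
  have hσm : σ m = s.i := by simp [hm]
  have hσm' : σ m' = s.j := by simp [hm']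
  have hdm := depth_succ θ σ m
  have hdm' := depth_succ θ σ m'
  rw [hσm] at hdm
  rw [hσm'] at hdm'
  have hlt : m < m' := by
    rcases lt_trichotomy m m' with hc | hc | hc
    · exact hc
    · exact absurd s.lt (by rw [← hσm, ← hσm', hc]; exact lt_irrefl _)
    · have := depth_mono hθ σ (show m'.val + 1 ≤ m.val from hc)
      linarith
  have hle1 := depth_mono hθ σ (show m.val + 1 ≤ m'.val from hlt)
  have hyd : y = depth θ σ m.val + hgt θ s.i := by linarith
  have hsucc : m'.val = m.val + 1 := by
    by_contra hc
    have hlt' : m.val + 1 < m'.val := lt_of_le_of_ne hlt (Ne.symm hc)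
    have hn' : m.val + 1 < n := hlt'.trans m'.isLt
    have h2 := depth_succ θ σ ⟨m.val + 1, hn'⟩
    have h3 := depth_mono hθ σ (show m.val + 1 + 1 ≤ m'.val from hlt')
    have h4 := hθ.hgt_pos (σ ⟨m.val + 1, hn'⟩)
    simp only at h2
    linarith
  have hlab : σ m < σ m' := by rw [hσm, hσm']; exact s.lt
  refine ⟨m, m', hsucc, hlab, ?_⟩
  have htop : pathVertex θ σ m.val = s.top := by
    rw [abscissa_edge hθ σ m (by linarith) (by rw [hσm]; linarith), hσm, hv] at htX
    have him : depth θ σ m.val = -(pathVertex θ σ m.val).im := rfl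
    have : y - depth θ σ m.val = hgt θ s.i := by linarith
    rw [this] at htX
    exact Complex.ext (by linarith) (by linarith)
  have : cornerTile θ σ m m' hlab = s := by
    cases s
    simp only [cornerTile, Tile.mk.injEq]
    exact ⟨htop, hσm, hσm'⟩
  rwa [this]

/-- The interiors of the remaining tiles avoid the corner tile, so they lie to the right of the new
path; the closed tiles follow by taking limits. -/
theorem remove (hθ : Admissible θ) (h : IsPartialTiling θ w σ T) {m m' : Fin n}
    (hm : m'.val = m.val + 1) (hlt : σ m < σ m') (ht : cornerTile θ σ m m' hlt ∈ T) :
    IsPartialTiling θ w (σ * swap m m') (T \ {cornerTile θ σ m m' hlt}) where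
  finite := h.finite.sdiff
  le y := by
    by_cases hy : depth θ σ m.val < y ∧ y < depth θ σ m.val + (hgt θ (σ m) + hgt θ (σ m'))
    · have := (h.subset _ ht ⟨abscissa θ (σ * swap m m') y, -y⟩ ((mem_cornerTile hθ hm hlt _).2
        ⟨by simpa using ⟨hy.1.le, hy.2.le⟩, by simpa using abscissa_le_mul_swap hθ hm hlt y,
          by simp⟩)).2.2
      simpa using this
    · rw [abscissa_mul_swap_of_notMem hθ hm]
      · exact h.le y
      · by_contra! hc
        exact hy hc
  subset s hs p hp := by
    obtain ⟨h0, h1, h2⟩ := h.subset s hs.1 p hp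
    refine ⟨h0, ?_, h2⟩
    have hX := continuous_abscissa θ (σ * swap m m')
    have hclosed : IsClosed {q : ℂ | abscissa θ (σ * swap m m') (-q.im) ≤ q.re} := by
      have hre := Complex.continuous_re
      have him := Complex.continuous_im
      refine isClosed_le ?_ ?_ <;> fun_prop
    have hint : interior (s.carrier θ) ⊆ {q : ℂ | abscissa θ (σ * swap m m') (-q.im) ≤ q.re} := by
      intro q hq
      by_contra hc
      have hc' : q.re < abscissa θ (σ * swap m m') (-q.im) := not_le.1 hc
      have hq' := abscissa_lt_of_mem_interior (fun q hq => (h.subset s hs.1 q hq).2.1) hq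
      exact Set.disjoint_left.1 (h.disjoint s hs.1 _ ht hs.2) hq
        (mem_interior_cornerTile hθ hm hlt hq' hc')
    obtain ⟨a, ha, b, hb, hab⟩ := hp
    let F : ℝ × ℝ → ℂ := fun x => s.top + (x.1 : ℂ) * dir θ s.i + (x.2 : ℂ) * dir θ s.j
    have hF : Continuous F := by fun_prop
    have hmem : (a, b) ∈ closure (Set.Ioo (0 : ℝ) 1 ×ˢ Set.Ioo (0 : ℝ) 1) := by
      rw [closure_prod_eq, closure_Ioo zero_ne_one]
      exact ⟨ha, hb⟩
    have := closure_minimal (t := F ⁻¹' {q : ℂ | abscissa θ (σ * swap m m') (-q.im) ≤ q.re}) ?_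
      (hclosed.preimage hF) hmem
    · rw [hab]; exact this
    · rintro ⟨a, b⟩ ⟨⟨ha0, ha1⟩, hb0, hb1⟩
      refine hint (s.mem_interior hθ ?_ ?_)
      all_goals
        have hi := hθ.hgt_pos s.i
        have hj := hθ.hgt_pos s.j
        have hs : 0 < slope θ s.j - slope θ s.i := sub_pos.2 (hθ.slope_strictMono s.lt)
        obtain ⟨e1, e2⟩ := s.coords hθ (p := F (a, b)) (a := a) (b := b) rfl
        have f1 := mul_pos (mul_pos hs hj) hb0
        have f2 := mul_pos (mul_pos hs hj) (sub_pos.2 hb1)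
        have f3 := mul_pos (mul_pos hs hi) ha0
        have f4 := mul_pos (mul_pos hs hi) (sub_pos.2 ha1)
        simp only at ha0 ha1 hb0 hb1
        rw [e1, e2]
        simp only [Tile.left, Tile.right, max_lt_iff, lt_min_iff]
        constructor <;> linarith
  cover p h1 h2 := by
    obtain ⟨t, ht', htp⟩ := h.cover p ((abscissa_le_mul_swap hθ hm hlt _).trans_lt h1) h2
    refine ⟨t, ⟨ht', ?_⟩, htp⟩
    rintro rfl
    exact absurd ((mem_cornerTile hθ hm hlt p).1 htp).2.2 (not_le.2 h1)
  disjoint s hs t ht hst := h.disjoint s hs.1 t ht.1 hst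

end IsPartialTiling

/-- At the first difference the paths would leave a common vertex with different slopes. -/
theorem eq_of_abscissa_eq (hθ : Admissible θ) {σ τ : Perm (Fin n)}
    (h : ∀ y, abscissa θ σ y = abscissa θ τ y) : σ = τ := by
  have key : ∀ N : ℕ, ∀ m : Fin n, m.val = N → σ m = τ m := by
    intro N
    induction N using Nat.strong_induction_on with
    | _ N ih =>
      intro m hmN
      have hp : pathVertex θ σ m.val = pathVertex θ τ m.val := by
        unfold pathVertex
        refine Finset.sum_congr rfl fun l hl => ?_
        rw [ih l.val (by simpa [← hmN] using hl) l rfl]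
      have hd : depth θ σ m.val = depth θ τ m.val := by rw [depth, depth, hp]
      obtain ⟨ε, hε, hε'⟩ : ∃ ε, 0 < ε ∧ ε < min (hgt θ (σ m)) (hgt θ (τ m)) :=
        exists_between (lt_min (hθ.hgt_pos _) (hθ.hgt_pos _))
      rw [lt_min_iff] at hε'
      have h1 := h (depth θ σ m.val + ε)
      rw [abscissa_edge hθ σ m (by linarith) (by linarith),
        abscissa_edge hθ τ m (by linarith) (by linarith), hp, hd, add_sub_cancel_left] at h1
      exact hθ.slope_strictMono.injective (mul_right_cancel₀ hε.ne' (add_left_cancel h1))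
  exact Equiv.ext fun m => key m.val m rfl

theorem abscissa_eq_of_notMem (hθ : Admissible θ) (σ τ : Perm (Fin n)) {y : ℝ}
    (hy : y < 0 ∨ ∑ i, hgt θ i < y) : abscissa θ σ y = abscissa θ τ y := by
  rcases hy with hy | hy
  · have key : ∀ σ : Perm (Fin n), abscissa θ σ y = 0 := by
      intro σ
      refine Finset.sum_eq_zero fun m _ => ?_
      have := depth_mono hθ σ (Nat.zero_le m.val)
      rw [depth_zero] at this
      rw [clip, max_eq_left ((min_le_left _ _).trans (by linarith)), mul_zero]
    rw [key, key]
  · have key : ∀ σ : Perm (Fin n), abscissa θ σ y = ∑ i, slope θ i * hgt θ i := by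
      intro σ
      rw [← Equiv.sum_comp σ]
      refine Finset.sum_congr rfl fun m _ => ?_
      have := depth_mono hθ σ (show m.val + 1 ≤ n from m.isLt)
      rw [depth_succ, depth_card] at this
      rw [clip, min_eq_right (by linarith), max_eq_right (hθ.hgt_pos _).le]
    rw [key, key]

theorem IsPartialTiling.peels (hθ : Admissible θ) (hn : 0 < n) (h : IsPartialTiling θ w σ T) :
    Peels θ w σ T := by
  induction hN : T.ncard generalizing σ T with
  | zero =>
    obtain rfl := (Set.ncard_eq_zero h.finite).1 hN
    have : σ = w := by
      refine eq_of_abscissa_eq hθ fun y => (h.le y).antisymm ?_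
      by_contra! hlt
      obtain ⟨x, hx0, hx1⟩ := exists_between hlt
      obtain ⟨t, ht, -⟩ := h.cover ⟨x, -y⟩ (by simpa using hx0) (by simpa using hx1)
      exact ht
    subst this
    exact Peels.refl
  | succ N ih =>
    have hne : T.Nonempty := Set.nonempty_of_ncard_ne_zero (by omega)
    obtain ⟨m, m', hm, hlt, ht⟩ := h.exists_cornerTile hθ hn hne
    have h1 := Peels.step σ m m' hm hlt _ (ih (h.remove hθ hm hlt ht)
      (by rw [Set.ncard_sdiff_singleton_of_mem ht]; omega))
    rwa [Set.insert_sdiff_singleton, Set.insert_eq_of_mem ht] at h1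

/-- Every rhombic tiling arises by moving the left boundary across one corner tile after another. -/
theorem IsRhombicTiling.peels (hθ : Admissible θ) (hn : 0 < n) {T : Finset (Tile n)}
    (h : IsRhombicTiling θ w T) : Peels θ w 1 (T : Set (Tile n)) := by
  refine IsPartialTiling.peels hθ hn ⟨T.finite_toSet, fun y => ?_, fun t ht p hp => ?_,
    fun p h1 h2 => ?_, h.disjoint⟩
  · obtain ⟨T', -, hT'⟩ := (Peels.refl (θ := θ) (w := w)).exists_one
    exact hT'.abscissa_le hθ y
  · rw [← mem_polygon hθ w hn, ← h.cover]
    exact Set.mem_iUnion₂.2 ⟨t, ht, hp⟩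
  · have hp : p ∈ polygon θ w := by
      rw [mem_polygon hθ w hn]
      refine ⟨?_, h1.le, h2.le⟩
      by_contra hc
      rw [abscissa_eq_of_notMem hθ 1 w] at h1
      · linarith
      · by_contra! hc'
        exact hc hc'
    rw [← h.cover] at hp
    obtain ⟨t, ht, htp⟩ := Set.mem_iUnion₂.1 hp
    exact ⟨t, ht, htp⟩

end

/-! ### Position of tiles at the leftside boundary, and the equivalences. -/

section

variable {n : ℕ} {θ : Fin n → ℝ} {w σ : Perm (Fin n)} {T : Set (Tile n)}

/-- Unit segments that go down in admissible directions are equal only if they have the same top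
and the same direction. -/
theorem segment_dir_inj (hθ : Admissible θ) {p q : ℂ} {i j : Fin n}
    (h : segment ℝ p (p + dir θ i) = segment ℝ q (q + dir θ j)) : p = q ∧ i = j := by
  have key : ∀ (p q : ℂ) (i j : Fin n), p ∈ segment ℝ q (q + dir θ j) →
      p + dir θ i ∈ segment ℝ q (q + dir θ j) →
      ∃ s t : ℝ, 0 ≤ s ∧ t ≤ 1 ∧ p = q + s • dir θ j ∧ p + dir θ i = q + t • dir θ j := by
    intro p q i j h1 h2
    rw [segment_eq_image'] at h1 h2
    obtain ⟨s, hs, hs'⟩ := h1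
    obtain ⟨t, ht, ht'⟩ := h2
    rw [add_sub_cancel_left] at hs' ht'
    exact ⟨s, t, hs.1, ht.2, hs'.symm, ht'.symm⟩
  obtain ⟨s, t, hs, ht, e1, e2⟩ := key p q i j (h ▸ left_mem_segment ℝ _ _)
    (h ▸ right_mem_segment ℝ _ _)
  obtain ⟨s', t', hs', ht', e3, e4⟩ := key q p j i (h ▸ left_mem_segment ℝ _ _)
    (h ▸ right_mem_segment ℝ _ _)
  have hi := hθ.hgt_pos i
  have hj := hθ.hgt_pos j
  have c1 := congrArg Complex.im e1
  have c3 := congrArg Complex.im e3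
  simp only [Complex.add_im, Complex.smul_im, dir_im, smul_eq_mul] at c1 c3
  have hs0 : s = 0 := by
    have h1 := mul_nonneg hs hj.le
    have h2 := mul_nonneg hs' hi.le
    have h3 : s * hgt θ j = 0 := by linarith
    exact (mul_eq_zero.1 h3).resolve_right hj.ne'
  have hpq : p = q := by rw [e1, hs0, zero_smul, add_zero]
  refine ⟨hpq, ?_⟩
  rw [hpq] at e2
  have e5 := add_left_cancel e2
  have d1 := congrArg Complex.im e5
  have d2 := congrArg Complex.re e5
  simp only [Complex.smul_im, Complex.smul_re, dir_im, hθ.dir_re, smul_eq_mul] at d1 d2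
  apply hθ.slope_strictMono.injective
  have h6 : hgt θ i = t * hgt θ j := by linarith
  rw [h6] at d2
  have ht0 : t * hgt θ j ≠ 0 := by rw [← h6]; exact hi.ne'
  refine mul_right_cancel₀ ht0 ?_
  linarith

theorem leftEdge_eq (θ : Fin n → ℝ) (m : Fin n) :
    leftEdge θ m = segment ℝ (pathVertex θ 1 m.val) (pathVertex θ 1 m.val + dir θ m) := by
  rw [leftEdge, pathEdge, pathVertex_succ, Perm.one_apply]

theorem sharesLeft_of_top {t : Tile n} (hk : t.j.val = t.i.val + 1)
    (htop : t.top = pathVertex θ 1 t.i.val) : SharesLeft θ t := by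
  refine ⟨t.i, t.j, hk, ?_, ?_⟩
  · rw [leftEdge_eq, ← htop]
    exact Or.inl rfl
  · rw [leftEdge_eq, hk, pathVertex_succ, ← htop, Perm.one_apply]
    exact Or.inr (Or.inr (Or.inr rfl))

/-- Labels increase down the leftside boundary, so the shared edges carry `t.i` and then `t.j`. The
lower right edge, also labeled `t.i`, is excluded: it ends at the bottom of the tile. -/
theorem SharesLeft.top_eq (hθ : Admissible θ) {t : Tile n} (h : SharesLeft θ t) :
    t.top = pathVertex θ 1 t.i.val := by
  obtain ⟨m, m', hm, h1, h2⟩ := h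
  have key : ∀ m, leftEdge θ m ∈ t.edges θ →
      (m = t.i ∧ (pathVertex θ 1 m.val = t.top ∨ pathVertex θ 1 m.val = t.top + dir θ t.j)) ∨
      (m = t.j ∧ (pathVertex θ 1 m.val = t.top ∨ pathVertex θ 1 m.val = t.top + dir θ t.i)) := by
    intro m hm
    rw [leftEdge_eq] at hm
    rcases hm with hm | hm | hm | hm
    · obtain ⟨a, b⟩ := segment_dir_inj hθ hm
      exact Or.inl ⟨b, Or.inl a⟩
    · obtain ⟨a, b⟩ := segment_dir_inj hθ hm
      exact Or.inr ⟨b, Or.inl a⟩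
    · rw [add_right_comm] at hm
      obtain ⟨a, b⟩ := segment_dir_inj hθ hm
      exact Or.inl ⟨b, Or.inr a⟩
    · obtain ⟨a, b⟩ := segment_dir_inj hθ hm
      exact Or.inr ⟨b, Or.inr a⟩
  have hlt := t.lt
  rw [Fin.lt_def] at hlt
  have hs := pathVertex_succ θ 1 m
  rw [Perm.one_apply, ← hm] at hs
  have hij := hθ.hgt_pos t.i
  have hjj := hθ.hgt_pos t.j
  rcases key m h1 with ⟨rfl, h3⟩ | ⟨rfl, h3⟩ <;> rcases key m' h2 with ⟨rfl, h4⟩ | ⟨rfl, h4⟩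
  · omega
  · rcases h3 with h3 | h3
    · exact h3.symm
    · rw [hs, h3] at h4
      rcases h4 with h4 | h4 <;> have h5 := congrArg Complex.im h4 <;>
        simp only [Complex.add_im, dir_im] at h5 <;> linarith
  · omega
  · omega

/-- The vertices of the leftside boundary are extremal: no other sum of directions gives them. -/
theorem prefix_of_pathVertex_eq (hθ : Admissible θ) {k : Fin n} {j : ℕ}
    (h : pathVertex θ σ j = pathVertex θ 1 k.val) {v : Fin n} (hv : v ≠ k) :
    (σ.symm v).val < j ↔ v < k := by
  -- The functional `re + slope θ k * im` vanishes on direction `k`, is negative on smaller labels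
  -- and positive on larger ones. Its minimum over sums of distinct directions is reached only by
  -- taking all smaller labels, no larger ones, and `k` at will.
  let g : Fin n → ℝ := fun v => (slope θ v - slope θ k) * hgt θ v
  have hg : ∀ (τ : Perm (Fin n)) (j : ℕ),
      (pathVertex θ τ j).re + slope θ k * (pathVertex θ τ j).im
        = ∑ v, if (τ.symm v).val < j then g v else 0 := by
    intro τ j
    rw [pathVertex_eq_sum, Complex.re_sum, Complex.im_sum, Finset.mul_sum,
      ← Finset.sum_add_distrib, Finset.sum_filter]
    refine Finset.sum_congr rfl fun v _ => ?_
    rw [hθ.dir_re, dir_im]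
    simp only [g]
    split_ifs
    · ring
    · rfl
  have hsum : ∑ v, ((if (σ.symm v).val < j then g v else 0) - if v < k then g v else 0) = 0 := by
    rw [Finset.sum_sub_distrib, ← hg, h, hg, sub_eq_zero]
    rfl
  have hneg : ∀ v, v < k → g v < 0 := fun v hv =>
    mul_neg_of_neg_of_pos (sub_neg.2 (hθ.slope_strictMono hv)) (hθ.hgt_pos v)
  have hpos : ∀ v, k < v → 0 < g v := fun v hv =>
    mul_pos (sub_pos.2 (hθ.slope_strictMono hv)) (hθ.hgt_pos v)
  have hnn : ∀ v ∈ Finset.univ,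
      0 ≤ (if (σ.symm v).val < j then g v else 0) - if v < k then g v else 0 := by
    intro v _
    rcases lt_trichotomy v k with hc | rfl | hc
    · have := hneg v hc
      rw [if_pos hc]
      split_ifs <;> linarith
    · have : g v = 0 := by simp [g]
      simp [this]
    · have := hpos v hc
      rw [if_neg hc.not_gt]
      split_ifs <;> linarith
  have hz := (Finset.sum_eq_zero_iff_of_nonneg hnn).1 hsum v (Finset.mem_univ v)
  rcases lt_or_gt_of_ne hv with hc | hc
  · have := hneg v hc
    rw [if_pos hc] at hz
    by_contra hcon
    rw [if_neg (fun e => hcon ⟨fun _ => hc, fun _ => e⟩)] at hz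
    linarith
  · have := hpos v hc
    rw [if_neg hc.not_gt] at hz
    by_contra hcon
    have hj : (σ.symm v).val < j := by
      by_contra e
      exact hcon ⟨fun e' => absurd e' e, fun e' => absurd e' hc.not_gt⟩
    rw [if_pos hj] at hz
    linarith

theorem Tile.labels_eq {t : Tile n} {k k' : Fin n} (hk : k < k') (h : t.labels = {k, k'}) :
    t.i = k ∧ t.j = k' := by
  have h1 : t.i ∈ ({k, k'} : Set (Fin n)) := h ▸ Or.inl rfl
  have h2 : t.j ∈ ({k, k'} : Set (Fin n)) := h ▸ Or.inr rfl
  have h3 := t.lt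
  simp only [Set.mem_insert_iff, Set.mem_singleton_iff] at h1 h2
  rw [Fin.lt_def] at h3 hk
  simp only [Fin.ext_iff] at *
  omega

/-- A tiling whose tile with labels `k` and `k'` is away from the leftside boundary, because the
path that passes it has the value `v` on the wrong side. -/
theorem not_forced_of_descent (hθ : Admissible θ) (hn : 2 ≤ n) (hw : FullySupported w)
    (h : Peels θ w σ T) {k k' v : Fin n} (hk : k < k')
    (hadj : (σ.symm k).val = (σ.symm k').val + 1) (hvk : v ≠ k) (hvk' : v ≠ k')
    (hv : ¬ (σ.symm v < σ.symm k' ↔ v < k)) {t : Tile n} (hi : t.i = k) (hj : t.j = k') :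
    ¬ IsForcedLeftTile θ w t := by
  intro hforced
  have hu := h.undo hadj (by simpa using hk)
  obtain ⟨T', hT', hp⟩ := hu.exists_one
  obtain ⟨ht, hs⟩ := hforced _ (hp.isRhombicTiling hθ hn hw)
  have heq := hp.eq_of_labels (by simpa using ht) (hT' (Set.mem_insert _ _))
    (by simpa [cornerTile] using hi) (by simpa [cornerTile] using hj)
  have htop := hs.top_eq hθ
  rw [hi] at htop
  have htop' : t.top = pathVertex θ (σ * swap (σ.symm k') (σ.symm k)) (σ.symm k').val := by
    rw [heq]; rfl
  have := prefix_of_pathVertex_eq hθ (htop'.symm.trans htop) hvk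
  rw [mul_swap_symm_apply, swap_apply_of_ne_of_ne (fun e => hvk' (σ.symm.injective e))
    (fun e => hvk (σ.symm.injective e))] at this
  exact hv this

theorem exists_isForcedLeftTile_iff (hθ : Admissible θ)
    (hw : FullySupported w)
    (k k' : Fin n) (hk : k'.val = k.val + 1) :
    ((∃ t : Tile n, t.labels = {k, k'} ∧ IsForcedLeftTile θ w t) ↔
      (w.symm k' < w.symm k ∧ ¬ TogetherIn321 w k k')) ∧
    ((w.symm k' < w.symm k ∧ ¬ TogetherIn321 w k k') ↔
      (IsLRMax w k' ∧ IsRLMin w k)) := by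
  have hn : 2 ≤ n := by have := k'.isLt; omega
  have hkk' : k < k' := by rw [Fin.lt_def]; omega
  refine ⟨⟨?_, fun h => ?_⟩, not_togetherIn321_iff hw hk⟩
  · rintro ⟨t, hlab, hforced⟩
    obtain ⟨hi, hj⟩ := t.labels_eq hkk' hlab
    refine ⟨?_, ?_⟩
    · obtain ⟨T, -, hT⟩ := (Peels.refl (θ := θ) (w := w)).exists_one
      have := hT.inv_of_mem (by simpa using (hforced _ (hT.isRhombicTiling hθ hn hw)).1)
      rwa [hi, hj] at this
    · rintro ⟨a, b, c, hab, hbc, h1, h2, hx, hy⟩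
      obtain ⟨τ, T, hT, e1, e2⟩ := (Peels.refl (θ := θ) (w := w)).exists_consecutive h1 h2
        (by simpa using hab) (by simpa using hbc)
      have hcases : (k' = w a ∧ k = w b) ∨ (k' = w b ∧ k = w c) := by
        simp only [Set.mem_insert_iff, Set.mem_singleton_iff, Fin.ext_iff, Fin.lt_def] at *
        omega
      rcases hcases with ⟨rfl, rfl⟩ | ⟨rfl, rfl⟩
      -- The third entry `w c` comes after `k'` although it is smaller than `k`.
      · refine not_forced_of_descent hθ hn hw hT hkk' e1 h2.ne (h2.trans h1).ne (v := w c) ?_ hi hj hforced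
        intro hiff
        have := hiff.2 h2
        rw [Fin.lt_def] at this
        omega
      -- The third entry `w a` comes before `k'` although it is larger than `k`.
      · refine not_forced_of_descent hθ hn hw hT hkk' e2 (h2.trans h1).ne' h1.ne' (v := w a) ?_ hi hj hforced
        intro hiff
        have := hiff.1 (by rw [Fin.lt_def]; omega)
        exact absurd this (h2.trans h1).not_gt
  · obtain ⟨hmax, hmin⟩ := (not_togetherIn321_iff hw hk).1 h
    have hall : ∀ T : Finset (Tile n), IsRhombicTiling θ w T →
        (⟨pathVertex θ 1 k.val, k, k', hkk'⟩ : Tile n) ∈ T := by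
      intro T hT
      obtain ⟨t, ht, hi, hj, htop⟩ := (hT.peels hθ (by omega)).exists_tile_of_fixed hk hmax hmin h.1
        (fun v => Iff.rfl) rfl rfl
      cases t
      simp only at hi hj htop
      subst hi hj htop
      exact ht
    exact ⟨⟨pathVertex θ 1 k.val, k, k', hkk'⟩, rfl, fun T hT => ⟨hall T hT, sharesLeft_of_top hk rfl⟩⟩

end

end Elnitsky

end

theorem corollary4 {n : ℕ} (θ : Fin n → ℝ) (hθ : Elnitsky.Admissible θ)
    (w : Equiv.Perm (Fin n)) (hw : Elnitsky.FullySupported w)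
    (k k' : Fin n) (hk : k'.val = k.val + 1) :
    ((∃ t : Elnitsky.Tile n, t.labels = {k, k'} ∧ Elnitsky.IsForcedLeftTile θ w t) ↔
      (w.symm k' < w.symm k ∧ ¬ Elnitsky.TogetherIn321 w k k')) ∧
    ((w.symm k' < w.symm k ∧ ¬ Elnitsky.TogetherIn321 w k k') ↔
      (Elnitsky.IsLRMax w k' ∧ Elnitsky.IsRLMin w k)) :=
  Elnitsky.exists_isForcedLeftTile_iff hθ hw k k' hk
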